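/- **Theorem (uniqueness for a non-moving crack).** Let $d\ge 1$, $T,\delta_0>0$, and let $\Omega\subset\mathbb R^d$ be a bounded open set with Lipschitz boundary. Let $\partial_D\Omega\subset\partial\Omega$ be a (possibly empty) Borel set and $\partial_N\Omega:=\partial\Omega\setminus\partial_D\Omega$. Let $\Gamma\subset\overline\Omega$ be closed with $\mathcal L^d(\Gamma)=0$ and $\mathcal H^{d-1}(\Gamma\cap\partial\Omega)=0$, such that every $x\in\Gamma$ has an open neighbourhood $U$ for which $(U\cap\Omega)\setminus\Gamma$ is the union of two disjoint open sets with Lipschitz boundary. Let $\{\Gamma_t\}_{t\in[0,T]}$ be an increasing family of closed subsets of $\Gamma$. Let $H$ denote $L^2(\Omega;\mathbb R^d)$, and, for fields of matrices, $L^2(\Omega;\mathbb R^{d\times d}_{sym})$ (with the Frobenius product); let $H_N:=L^2(\partial_N\Omega;\mathbb R^d)$ (with respect to $\mathcal H^{d-1}$), $U_t:=H^1(\Omega\setminus\Gamma_t;\mathbb R^d)$, $U_t^D:=\{u\in U_t: u=0\text{ on }\partial_D\Omega\text{ in the sense of traces}\}$ and $ev:=\frac12(\nabla v+\nabla v^T)$,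 where for $v\in U_t$ the gradient is the distributional one in $\Omega\setminus\Gamma_t$. Let $B:=L^\infty(\Omega;\mathcal L_{sym}(\mathbb R^{d\times d}_{sym},\mathbb R^{d\times d}_{sym}))$, where $\mathcal L_{sym}$ is the space of linear maps $\mathbb A$ with $\mathbb A\xi\cdot\eta=\mathbb A\eta\cdot\xi$. Assume $z\in W^{2,1}(0,T;U_0)$, $N\in W^{1,1}(0,T;H_N)$ (continuous representatives), $f\in L^2(0,T;H)$, $u^0\in U_0$ with $u^0-z(0)\in U_0^D$, and $u^1\in H$. Let $\mathbb C\in B$ be coercive: there is $\gamma>0$ with $\mathbb C(x)\xi\cdot\xi\ge\gamma|\xi|^2$ for every $\xi\in\mathbb R^{d\times d}_{sym}$ and a.e. $x\in\Omega$. Let $\mathbb F\in C^2(0,T+\delta_0;B)\cap L^1(0,T+\delta_0;B)$ satisfy, for every $\xi\in\mathbb R^{d\times d}_{sym}$, every $t\in(0,T+\delta_0)$ and a.e. $x\in\Omega$, $$\mathbb F(t,x)\xi\cdot\xi\ge0,\qquad \dot{\mathbb F}(t,x)\xi\cdot\xi\le0,\qquad \ddot{\mathbb F}(t,x)\xi\cdot\xi\ge0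 .$$ A *generalized solution* is a weakly continuous function $u\colon[0,T]\to U_T$, with distributional time derivative $\dot u$ weakly continuous from $[0,T]$ to $H$ and with $u(t)\in U_t$ for every $t\in[0,T]$, such that $u(t)-z(t)\in U_t^D$ for every $t\in[0,T]$, $u(0)=u^0$ in $U_0$, $\dot u(0)=u^1$ in $H$, and $$-\int_0^T(\dot u(t),\dot\varphi(t))_H\,dt+\int_0^T(\mathbb C eu(t),e\varphi(t))_H\,dt-\int_0^T\!\!\int_0^t(\mathbb F(t-r)(eu(r)-eu^0),e\dot\varphi(t))_H\,dr\,dt$$ $$=\int_0^T(f(t),\varphi(t))_H\,dt+\int_0^T(N(t),\varphi(t))_{H_N}\,dt$$ for every $\varphi\in C^1_c(0,T;U_T^D)$ with $\varphi(t)\in U_t^D$ for every $t\in[0,T]$. (This is the weak form of the fractional Kelvin–Voigt system $\ddot u-\operatorname{div}\big(\mathbb C eu+\tfrac{d}{dt}\int_0^t\mathbb F(t-r)(eu(r)-eu^0)\,dr\big)=f$ in $\Omega\setminus\Gamma_t$, $u=z$ on $\partial_D\Omega$, with normal stress $N$ on $\partial_N\Omega$ and $0$ on $\Gamma_t$, and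 initial data $u^0,u^1$.) If the crack does not move, i.e. $\Gamma_T=\Gamma_0$, then there exists at most one generalized solution: any two generalized solutions $u_1,u_2$ satisfy $u_1(t)=u_2(t)$ in $U_T$ for every $t\in[0,T]$. -/

import Mathlib

open MeasureTheory Set Filter Topology
open scoped ContDiff ENNReal RealInnerProductSpace

namespace FracKV

/-! ## Vectors, matrices, symmetric matrices -/

/-- `ℝᵈ` with the Euclidean norm. -/
abbrev Vec (d : ℕ) : Type := EuclideanSpace ℝ (Fin d)

/-- `ℝ^{d×d}` with the Frobenius inner product; the entry in row `i` and column `j` of `A` is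
`A (i, j)`. -/
abbrev Mat (d : ℕ) : Type := EuclideanSpace ℝ (Fin d × Fin d)

/-- The subspace of symmetric matrices. -/
def symMat (d : ℕ) : Submodule ℝ (Mat d) where
  carrier := {A | ∀ i j, A (i, j) = A (j, i)}
  add_mem' := by
    intro A B hA hB i j
    simp [hA i j, hB i j]
  zero_mem' := by
    intro i j
    simp
  smul_mem' := by
    intro c A hA i j
    simp [hA i j]

/-- The symmetric part `A ↦ (A + Aᵀ) / 2`, as a continuous linear map. -/
noncomputable def symPart (d : ℕ) : Mat d →L[ℝ] symMat d :=
  LinearMap.toContinuousLinearMap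
    { toFun := fun A => ⟨WithLp.toLp 2 (fun p => (A p + A (p.2, p.1)) / 2), by
        intro i j
        simp [add_comm]⟩
      map_add' := by
        intro A B
        ext p
        simp
        ring
      map_smul' := by
        intro c A
        ext p
        simp
        ring }

/-! ## Function spaces on `Ω` -/

/-- `H = L²(Ω; ℝᵈ)`. -/
abbrev L2Vec (d : ℕ) (Ω : Set (Vec d)) : Type := Lp (Vec d) 2 (volume.restrict Ω)

/-- `L²(Ω; ℝ^{d×d})`. -/
abbrev L2Mat (d : ℕ) (Ω : Set (Vec d)) : Type := Lp (Mat d) 2 (volume.restrict Ω)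

/-- `L²(Ω; ℝ^{d×d}_sym)`. -/
abbrev L2Sym (d : ℕ) (Ω : Set (Vec d)) : Type := Lp (symMat d) 2 (volume.restrict Ω)

/-- `L^∞(Ω; 𝓛(ℝ^{d×d}_sym, ℝ^{d×d}_sym))`. -/
abbrev TensorField (d : ℕ) (Ω : Set (Vec d)) : Type :=
  Lp (symMat d →L[ℝ] symMat d) ∞ (volume.restrict Ω)

/-- `𝔸 ∈ B = L^∞(Ω; 𝓛_sym(ℝ^{d×d}_sym, ℝ^{d×d}_sym))`: the values of `𝔸` are almost everywhere
symmetric, `𝔸(x) ξ · η = 𝔸(x) η · ξ`. This is a closed subspace of `TensorField d Ω`. -/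
def TensorSymm {d : ℕ} {Ω : Set (Vec d)} (A : TensorField d Ω) : Prop :=
  ∀ ξ η : symMat d, ∀ᵐ x ∂(volume.restrict Ω), ⟪A x ξ, η⟫ = ⟪A x η, ξ⟫

/-- Pointwise almost everywhere non-negativity of a tensor field: `𝔸(x) ξ · ξ ≥ 0`. -/
def TensorNonneg {d : ℕ} {Ω : Set (Vec d)} (A : TensorField d Ω) : Prop :=
  ∀ ξ : symMat d, ∀ᵐ x ∂(volume.restrict Ω), 0 ≤ ⟪A x ξ, ξ⟫

/-- Pointwise almost everywhere non-positivity of a tensor field: `𝔸(x) ξ · ξ ≤ 0`. -/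
def TensorNonpos {d : ℕ} {Ω : Set (Vec d)} (A : TensorField d Ω) : Prop :=
  ∀ ξ : symMat d, ∀ᵐ x ∂(volume.restrict Ω), ⟪A x ξ, ξ⟫ ≤ 0

/-- Coercivity of a tensor field: `𝔸(x) ξ · ξ ≥ γ |ξ|²` for some `γ > 0`. -/
def TensorCoercive {d : ℕ} {Ω : Set (Vec d)} (A : TensorField d Ω) : Prop :=
  ∃ γ : ℝ, 0 < γ ∧ ∀ ξ : symMat d, ∀ᵐ x ∂(volume.restrict Ω), γ * ‖ξ‖ ^ 2 ≤ ⟪A x ξ, ξ⟫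

/-- `(𝔸 ξ, η)` in `L²(Ω; ℝ^{d×d}_sym)`. -/
noncomputable def tensorForm {d : ℕ} {Ω : Set (Vec d)} (A : TensorField d Ω) (ξ η : L2Sym d Ω) :
    ℝ :=
  ∫ x in Ω, ⟪A x (ξ x), η x⟫

/-- Pairs of a square-integrable vector field and a square-integrable matrix field (the
candidate for its gradient), with the norm `(‖u‖² + ‖G‖²)^{1/2}`. -/
abbrev L2Pair (d : ℕ) (Ω : Set (Vec d)) : Type := WithLp 2 (L2Vec d Ω × L2Mat d Ω)

/-- The `j`-th partial derivative of a scalar function. -/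
noncomputable def partialDeriv {d : ℕ} (φ : Vec d → ℝ) (j : Fin d) (x : Vec d) : ℝ :=
  fderiv ℝ φ x (EuclideanSpace.single j 1)

/-- `G` is the distributional gradient of `u` in `Ω ∖ K`: `G i j = ∂_j u_i`. -/
def IsWeakGrad {d : ℕ} (Ω K : Set (Vec d)) (u : L2Vec d Ω) (G : L2Mat d Ω) : Prop :=
  ∀ φ : Vec d → ℝ, ContDiff ℝ ∞ φ → HasCompactSupport φ → tsupport φ ⊆ Ω \ K →
    ∀ i j : Fin d, ∫ x in Ω, u x i * partialDeriv φ j x = - ∫ x in Ω, G x (i, j) * φ x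

theorem integrable_mul_test {d : ℕ} {ι : Type*} [Fintype ι] {Ω : Set (Vec d)}
    (u : Lp (EuclideanSpace ℝ ι) 2 (volume.restrict Ω)) (i : ι) {g : Vec d → ℝ}
    (hg : Continuous g) (hc : HasCompactSupport g) :
    Integrable (fun x => u x i * g x) (volume.restrict Ω) := by
  have h1 : MemLp (fun x => u x i) 2 (volume.restrict Ω) :=
    (EuclideanSpace.proj (𝕜 := ℝ) i).comp_memLp' (Lp.memLp u)
  have h2 : MemLp g 2 (volume.restrict Ω) := hg.memLp_of_hasCompactSupport hc
  exact h1.integrable_mul h2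

theorem continuous_partialDeriv {d : ℕ} {φ : Vec d → ℝ} (hφ : ContDiff ℝ ∞ φ) (j : Fin d) :
    Continuous (partialDeriv φ j) :=
  (hφ.continuous_fderiv (by simp)).clm_apply continuous_const

theorem hasCompactSupport_partialDeriv {d : ℕ} {φ : Vec d → ℝ} (hφ : HasCompactSupport φ)
    (j : Fin d) : HasCompactSupport (partialDeriv φ j) :=
  hφ.fderiv_apply (𝕜 := ℝ) _

/-- The Sobolev space `H¹(Ω ∖ K; ℝᵈ)` for a Lebesgue-null closed set `K`, so that
`L²(Ω ∖ K) = L²(Ω)`: a function together with its distributional gradient in `Ω ∖ K`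
(not in `Ω`), with the `H¹` norm. -/
def H1 {d : ℕ} (Ω K : Set (Vec d)) : Submodule ℝ (L2Pair d Ω) where
  carrier := {w | IsWeakGrad Ω K w.fst w.snd}
  add_mem' := by
    intro v w hv hw φ h1 h2 h3 i j
    have e1 : ∀ᵐ x ∂(volume.restrict Ω), (v + w).fst x i * partialDeriv φ j x
        = v.fst x i * partialDeriv φ j x + w.fst x i * partialDeriv φ j x := by
      filter_upwards [Lp.coeFn_add v.fst w.fst] with x hx
      rw [WithLp.add_fst, hx]
      simp [add_mul]
    have e2 : ∀ᵐ x ∂(volume.restrict Ω), (v + w).snd x (i, j) * φ x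
        = v.snd x (i, j) * φ x + w.snd x (i, j) * φ x := by
      filter_upwards [Lp.coeFn_add v.snd w.snd] with x hx
      rw [WithLp.add_snd, hx]
      simp [add_mul]
    have c1 := continuous_partialDeriv h1 j
    have c2 := hasCompactSupport_partialDeriv h2 j
    rw [integral_congr_ae e1, integral_congr_ae e2,
      integral_add (integrable_mul_test v.fst i c1 c2) (integrable_mul_test w.fst i c1 c2),
      integral_add (integrable_mul_test v.snd (i, j) h1.continuous h2)
        (integrable_mul_test w.snd (i, j) h1.continuous h2),
      hv φ h1 h2 h3 i j, hw φ h1 h2 h3 i j]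
    ring
  zero_mem' := by
    intro φ h1 h2 h3 i j
    have e1 : ∀ᵐ x ∂(volume.restrict Ω),
        (0 : L2Pair d Ω).fst x i * partialDeriv φ j x = 0 := by
      filter_upwards [Lp.coeFn_zero (Vec d) 2 (volume.restrict Ω)] with x hx
      rw [WithLp.zero_fst, hx]
      simp
    have e2 : ∀ᵐ x ∂(volume.restrict Ω), (0 : L2Pair d Ω).snd x (i, j) * φ x = 0 := by
      filter_upwards [Lp.coeFn_zero (Mat d) 2 (volume.restrict Ω)] with x hx
      rw [WithLp.zero_snd, hx]
      simp
    rw [integral_congr_ae e1, integral_congr_ae e2]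
    simp
  smul_mem' := by
    intro c w hw φ h1 h2 h3 i j
    have e1 : ∀ᵐ x ∂(volume.restrict Ω), (c • w).fst x i * partialDeriv φ j x
        = c * (w.fst x i * partialDeriv φ j x) := by
      filter_upwards [Lp.coeFn_smul c w.fst] with x hx
      rw [WithLp.smul_fst, hx]
      simp [mul_assoc]
    have e2 : ∀ᵐ x ∂(volume.restrict Ω), (c • w).snd x (i, j) * φ x
        = c * (w.snd x (i, j) * φ x) := by
      filter_upwards [Lp.coeFn_smul c w.snd] with x hx
      rw [WithLp.smul_snd, hx]
      simp [mul_assoc]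
    rw [integral_congr_ae e1, integral_congr_ae e2, integral_const_mul, integral_const_mul,
      hw φ h1 h2 h3 i j]
    ring

/-- The function `w`, as an element of `L²(Ω; ℝᵈ)`. -/
noncomputable def fn {d : ℕ} {Ω K : Set (Vec d)} (w : H1 Ω K) : L2Vec d Ω :=
  (w : L2Pair d Ω).fst

/-- The symmetric gradient `e w`, as an element of `L²(Ω; ℝ^{d×d}_sym)`. -/
noncomputable def strain {d : ℕ} {Ω K : Set (Vec d)} (w : H1 Ω K) : L2Sym d Ω :=
  (symPart d).compLpL 2 (volume.restrict Ω) (w : L2Pair d Ω).snd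

/-! ## Boundary values -/

/-- `a` is the value at the boundary point `x` of the (inner) trace of `u`:
the mean of `|u - a|` over `B_r(x) ∩ Ω` tends to `0` as `r → 0⁺`. -/
def HasTraceAt {d : ℕ} (Ω : Set (Vec d)) (u : Vec d → Vec d) (x a : Vec d) : Prop :=
  Tendsto (fun r : ℝ => ⨍ y in Metric.ball x r ∩ Ω, ‖u y - a‖) (𝓝[>] 0) (𝓝 0)

/-- The trace of `u` on `∂Ω`: the limit of the means of `u` over `B_r(x) ∩ Ω` as `r → 0⁺`.
For Sobolev functions it exists, in the sense of `HasTraceAt`, at almost every boundary point. -/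
noncomputable def trace {d : ℕ} (Ω : Set (Vec d)) (u : Vec d → Vec d) (x : Vec d) : Vec d :=
  limUnder (𝓝[>] (0 : ℝ)) (fun r : ℝ => ⨍ y in Metric.ball x r ∩ Ω, u y)

/-- The surface measure `ℋ^{d-1}` on a subset `S` of `ℝᵈ`, normalised to agree with the
`(d-1)`-dimensional Lebesgue measure on hyperplanes. -/
noncomputable def surface {d : ℕ} (S : Set (Vec d)) : Measure (Vec d) :=
  (Measure.euclideanHausdorffMeasure (d - 1) : Measure (Vec d)).restrict S

/-- The set of the elements of `H¹(Ω ∖ K; ℝᵈ)` with vanishing trace on `D ⊆ ∂Ω`. -/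
def H1D {d : ℕ} (Ω D K : Set (Vec d)) : Set (L2Pair d Ω) :=
  {w | w ∈ H1 Ω K ∧ ∀ᵐ x ∂(surface D), HasTraceAt Ω w.fst x 0}

/-- `L²(S; ℝᵈ)` for the surface measure. -/
abbrev L2Bdry (d : ℕ) (S : Set (Vec d)) : Type := Lp (Vec d) 2 (surface S)

/-! ## Geometry -/

/-- The open set `U` has Lipschitz boundary: near each boundary point it is the strict
epigraph, over a hyperplane `n^⊥`, of a Lipschitz function (of which only the values on `n^⊥`
matter). -/
def HasLipschitzBoundary {d : ℕ} (U : Set (Vec d)) : Prop :=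
  ∀ x ∈ frontier U, ∃ n : Vec d, ‖n‖ = 1 ∧ ∃ r > 0, ∃ L : NNReal, ∃ γ : Vec d → ℝ,
    LipschitzWith L γ ∧ ∀ y ∈ Metric.ball x r, y ∈ U ↔ γ (y - ⟪n, y⟫ • n) < ⟪n, y⟫

/-- The standing assumptions on the reference configuration `Ω`, on the Dirichlet part `D` of
its boundary, and on the increasing cracks `Γt t`, `0 ≤ t ≤ T`, contained in `Γ`. -/
structure CrackGeometry {d : ℕ} (Ω D Γ : Set (Vec d)) (Γt : ℝ → Set (Vec d)) (T : ℝ) :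
    Prop where
  isOpen : IsOpen Ω
  isBounded : Bornology.IsBounded Ω
  lipschitz : HasLipschitzBoundary Ω
  dirichlet_subset : D ⊆ frontier Ω
  dirichlet_borel : MeasurableSet D
  crack_subset : Γ ⊆ closure Ω
  crack_closed : IsClosed Γ
  crack_null : volume Γ = 0
  crack_boundary_null : (Measure.euclideanHausdorffMeasure (d - 1) : Measure (Vec d)) (Γ ∩ frontier Ω) = 0
  crack_sides : ∀ x ∈ Γ, ∃ U : Set (Vec d), IsOpen U ∧ x ∈ U ∧ ∃ V W : Set (Vec d),
    IsOpen V ∧ IsOpen W ∧ Disjoint V W ∧ HasLipschitzBoundary V ∧ HasLipschitzBoundary W ∧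
      (U ∩ Ω) \ Γ = V ∪ W
  evolving_closed : ∀ t ∈ Icc 0 T, IsClosed (Γt t)
  evolving_subset : ∀ t ∈ Icc 0 T, Γt t ⊆ Γ
  evolving_mono : MonotoneOn Γt (Icc 0 T)

/-! ## Functions of time with values in a Banach space -/

section Time

variable {X : Type*} [NormedAddCommGroup X] [NormedSpace ℝ X]

/-- `u ∈ C⁰_w([0,T]; X)`. -/
def WeaklyContinuous (T : ℝ) (u : ℝ → X) : Prop :=
  ∀ ℓ : X →L[ℝ] ℝ, ContinuousOn (fun t => ℓ (u t)) (Icc 0 T)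

/-- `v` is the derivative of `u` on `(0,T)` in the sense of distributions. The identity
`∫ ψ' u = - ∫ ψ v` in `X` is stated after applying every continuous linear functional, so that
it makes sense for weakly continuous functions as it stands. -/
def IsTimeDeriv (T : ℝ) (u v : ℝ → X) : Prop :=
  ∀ ψ : ℝ → ℝ, ContDiff ℝ ∞ ψ → HasCompactSupport ψ → tsupport ψ ⊆ Ioo 0 T →
    ∀ ℓ : X →L[ℝ] ℝ, ∫ t in Ioo 0 T, deriv ψ t * ℓ (u t) = - ∫ t in Ioo 0 T, ψ t * ℓ (v t)

/-- `u ∈ W^{1,1}(0,T; X)`, `u` being the continuous representative. -/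
def MemW11 (T : ℝ) (u : ℝ → X) : Prop :=
  ContinuousOn u (Icc 0 T) ∧ ∃ v : ℝ → X, IntegrableOn v (Ioo 0 T) ∧ IsTimeDeriv T u v

/-- `u ∈ W^{2,1}(0,T; X)`, `u` being the continuous representative. -/
def MemW21 (T : ℝ) (u : ℝ → X) : Prop :=
  ContinuousOn u (Icc 0 T) ∧ ∃ v w : ℝ → X, IntegrableOn v (Ioo 0 T) ∧
    IntegrableOn w (Ioo 0 T) ∧ IsTimeDeriv T u v ∧ IsTimeDeriv T v w

end Time

/-! ## Generalized solutions -/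

/-- The test functions: `φ ∈ C¹_c(0,T; U_T^D)` with `φ(t) ∈ U_t^D` for every `t ∈ [0,T]`. -/
def IsTestFunction {d : ℕ} (Ω D : Set (Vec d)) (Γt : ℝ → Set (Vec d)) (T : ℝ)
    (φ : ℝ → H1 Ω (Γt T)) : Prop :=
  ContDiff ℝ 1 φ ∧ HasCompactSupport φ ∧ tsupport φ ⊆ Ioo 0 T ∧
    ∀ t ∈ Icc 0 T, (φ t : L2Pair d Ω) ∈ H1D Ω D (Γt t)

/-- `u : [0,T] → U_T = H¹(Ω ∖ Γ_T; ℝᵈ)` is a generalized solution of the fractional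
Kelvin-Voigt system with Dirichlet datum `z`, Neumann datum `N`, forcing term `f`, initial data
`u0`, `u1`, elastic tensor `C` and kernel `F`; `v` is the time derivative of `u` in `H`. -/
def IsGeneralizedSolution {d : ℕ} (Ω D : Set (Vec d)) (Γt : ℝ → Set (Vec d)) (T : ℝ)
    (z : ℝ → H1 Ω (Γt 0)) (N : ℝ → L2Bdry d (frontier Ω \ D)) (f : ℝ → L2Vec d Ω)
    (u0 : H1 Ω (Γt 0)) (u1 : L2Vec d Ω) (C : TensorField d Ω) (F : ℝ → TensorField d Ω)
    (u : ℝ → H1 Ω (Γt T)) : Prop :=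
  WeaklyContinuous T u ∧
  (∀ t ∈ Icc 0 T, (u t : L2Pair d Ω) ∈ H1 Ω (Γt t)) ∧
  (∀ t ∈ Icc 0 T, (u t : L2Pair d Ω) - (z t : L2Pair d Ω) ∈ H1D Ω D (Γt t)) ∧
  (u 0 : L2Pair d Ω) = (u0 : L2Pair d Ω) ∧
  ∃ v : ℝ → L2Vec d Ω, WeaklyContinuous T v ∧ IsTimeDeriv T (fun t => fn (u t)) v ∧ v 0 = u1 ∧
    ∀ φ : ℝ → H1 Ω (Γt T), IsTestFunction Ω D Γt T φ →
      - (∫ t in (0 : ℝ)..T, ⟪v t, fn (deriv φ t)⟫)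
        + (∫ t in (0 : ℝ)..T, tensorForm C (strain (u t)) (strain (φ t)))
        - (∫ t in (0 : ℝ)..T, ∫ r in (0 : ℝ)..t,
            tensorForm (F (t - r)) (strain (u r) - strain u0) (strain (deriv φ t)))
      = (∫ t in (0 : ℝ)..T, ⟪f t, fn (φ t)⟫)
        + ∫ t in (0 : ℝ)..T, ∫ x, ⟪N t x, trace Ω (fn (φ t)) x⟫ ∂(surface (frontier Ω \ D))

end FracKV

/-! Let `w` be the difference of two solutions. It solves the homogeneous problem with zero data.
The natural energy estimate would test with the velocity of `w`, but that velocity lies only in `H`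
and has no strain. The equation is therefore integrated in time until `w` itself and its primitives
are enough.

Because the crack is fixed, each value `w r` is an admissible direction at every time, so `η(t) • w
r` is a test function. The du Bois-Reymond lemma removes `η`
(`eq_sub_integral_of_integral_deriv_mul`). One integration in `t` then replaces the velocity by `w`,
and one in `r` replaces the direction `w r` by the primitive of `w`. With `Y = ∫ w`, `Q = ∫ e w` and
`Z = ∫ Q`, all from `0`, this gives `⟪w, Y⟫ + ⟪F * Q, Q⟫ + ⟪C Z, Q⟫ = 0`. Here `Y' = w` and `Z' =
Q`, so integrating over `(0, σ)` yields `‖Y σ‖² / 2 + ∫ ⟪F * Q, Q⟫ + ⟪C (Z σ), Z σ⟫ / 2 = 0`. The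
elastic term is non-negative. If the memory term is too, then `Y = 0`, hence `w = 0` in `H`
(`eq_zero_of_integrated_equation`), and a Sobolev function that is zero has zero gradient.

The memory term is non-negative because a non-negative, non-increasing, convex kernel is of positive
type. For a kernel smooth up to `0`, two integrations by parts in the lag express the quadratic form
through terms of known sign (`integral_kernel_nonneg_of_smooth`). A kernel with an integrable
singularity at `0` is the limit of its shifts `F(· + ε)`. Monotonicity dominates the shifted
quadratic forms by the original one, and `δ₀` leaves room for the shift (`integral_conv_nonneg`).

The argument runs in abstract Hilbert spaces (`eq_of_abstract_weak_formulation`). Tensor fields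
enter as multiplication operators on `L²`. -/

namespace FracKV

/-! ### Extension from `[0,T]` to the line. -/

/-- The function `p` on `[0,T]`, extended to `ℝ` by its boundary values. -/
def clamp {E : Type*} (T : ℝ) (p : ℝ → E) (t : ℝ) : E := p (max 0 (min t T))

theorem clamp_mem {T : ℝ} (hT : 0 ≤ T) (t : ℝ) : max 0 (min t T) ∈ Icc 0 T :=
  ⟨le_max_left _ _, max_le hT (min_le_right _ _)⟩

theorem clamp_of_mem {E : Type*} {T : ℝ} (p : ℝ → E) {t : ℝ} (ht : t ∈ Icc 0 T) : clamp T p t = p t := by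
  simp [clamp, min_eq_left ht.2, max_eq_right ht.1]

theorem clamp_of_nonpos {E : Type*} {T : ℝ} (hT : 0 ≤ T) (p : ℝ → E) {t : ℝ} (ht : t ≤ 0) :
    clamp T p t = p 0 := by
  simp [clamp, min_eq_left (ht.trans hT), max_eq_left ht]

theorem hasDerivAt_integral_of_continuous {E : Type*} [NormedAddCommGroup E] [NormedSpace ℝ E]
    [CompleteSpace E] {g : ℝ → E} (hg : Continuous g) (a t : ℝ) :
    HasDerivAt (fun t => ∫ s in a..t, g s) (g t) t :=
  intervalIntegral.integral_hasDerivAt_right (hg.intervalIntegrable _ _)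
    (hg.stronglyMeasurableAtFilter _ _) hg.continuousAt

/-! ### Weakly continuous functions: boundedness and measurability. -/

section WeakContinuity

variable {E F : Type*} [NormedAddCommGroup E] [NormedSpace ℝ E]
  [NormedAddCommGroup F] [NormedSpace ℝ F]

/-- Weak continuity on the whole real line. -/
def WeakCont (p : ℝ → E) : Prop :=
  ∀ ℓ : E →L[ℝ] ℝ, Continuous fun t => ℓ (p t)

theorem WeaklyContinuous.clamp {T : ℝ} (hT : 0 ≤ T) {p : ℝ → E} (hp : WeaklyContinuous T p) :
    WeakCont (clamp T p) := fun ℓ =>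
  (hp ℓ).comp_continuous (f := fun t : ℝ => max 0 (min t T)) (by fun_prop) (clamp_mem hT)

theorem WeaklyContinuous.comp_clm {T : ℝ} {p : ℝ → E} (hp : WeaklyContinuous T p)
    (A : E →L[ℝ] F) : WeaklyContinuous T fun t => A (p t) := fun ℓ => hp (ℓ.comp A)

theorem WeaklyContinuous.sub {T : ℝ} {p q : ℝ → E} (hp : WeaklyContinuous T p)
    (hq : WeaklyContinuous T q) : WeaklyContinuous T fun t => p t - q t := fun ℓ => by
  simp only [map_sub]
  exact (hp ℓ).sub (hq ℓ)

/-- Uniform boundedness, applied to the values as functionals on the dual. The dual is always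
complete, so `E` need not be. -/
theorem WeaklyContinuous.exists_norm_le {T : ℝ} {p : ℝ → E}
    (hp : WeaklyContinuous T p) : ∃ M, ∀ t ∈ Icc 0 T, ‖p t‖ ≤ M := by
  obtain ⟨M, hM⟩ := banach_steinhaus
    (g := fun t : Icc 0 T => NormedSpace.inclusionInDoubleDual ℝ E (p t)) (by
      intro ℓ
      obtain ⟨M, hM⟩ := isCompact_Icc.exists_bound_of_continuousOn (hp ℓ)
      exact ⟨M, fun t => hM t t.2⟩)
  refine ⟨M, fun t ht => ?_⟩
  have h := hM ⟨t, ht⟩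
  rwa [show ‖NormedSpace.inclusionInDoubleDual ℝ E (p t)‖ = ‖p t‖ from
    (NormedSpace.inclusionInDoubleDualLi ℝ).norm_map (p t)] at h

theorem WeaklyContinuous.exists_norm_clamp_le {T : ℝ} (hT : 0 ≤ T) {p : ℝ → E}
    (hp : WeaklyContinuous T p) : ∃ M, ∀ t, ‖FracKV.clamp T p t‖ ≤ M := by
  obtain ⟨M, hM⟩ := hp.exists_norm_le
  exact ⟨M, fun t => hM _ (clamp_mem hT t)⟩

theorem WeakCont.comp_clm {p : ℝ → E} (hp : WeakCont p) (A : E →L[ℝ] F) :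
    WeakCont fun t => A (p t) := fun ℓ => hp (ℓ.comp A)

/-- By Hahn-Banach a closed ball is an intersection of slabs `|ℓ x - ℓ a| ≤ r ‖ℓ‖`, and weak
continuity makes the preimage of each slab closed. -/
theorem WeakCont.isClosed_norm_sub_le {p : ℝ → E} (hp : WeakCont p) (a : E) (r : ℝ) :
    IsClosed {t | ‖p t - a‖ ≤ r} := by
  rcases lt_or_ge r 0 with hr | hr
  · convert isClosed_empty
    ext t
    simpa using hr.trans_le (norm_nonneg _)
  have : {t | ‖p t - a‖ ≤ r} = ⋂ ℓ : E →L[ℝ] ℝ, {t | ‖ℓ (p t) - ℓ a‖ ≤ r * ‖ℓ‖} := by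
    ext t
    simp only [mem_ofPred_eq, mem_iInter]
    constructor
    · intro h ℓ
      rw [← map_sub, mul_comm]
      exact (ℓ.le_opNorm _).trans (by gcongr)
    · intro h
      refine NormedSpace.norm_le_dual_bound ℝ (p t - a) hr fun ℓ => ?_
      rw [map_sub]
      exact h ℓ
  rw [this]
  exact isClosed_iInter fun ℓ => isClosed_le ((hp ℓ).sub continuous_const).norm continuous_const

/-- A weakly continuous function with values in a separable space is strongly measurable. -/
theorem WeakCont.stronglyMeasurable [SecondCountableTopology E] {p : ℝ → E} (hp : WeakCont p) :
    StronglyMeasurable p := by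
  borelize E
  refine Measurable.stronglyMeasurable ?_
  refine measurable_of_isOpen fun U hU => ?_
  -- By the Lindelöf property an open set is a countable union of closed balls, whose preimages are
  -- closed.
  have key : ∀ x ∈ U, ∃ r > 0, Metric.closedBall x r ⊆ U := fun x hx =>
    Metric.nhds_basis_closedBall.mem_iff.1 (hU.mem_nhds hx)
  choose! r hr hrU using key
  obtain ⟨S, hS, hSU⟩ := TopologicalSpace.isOpen_iUnion_countable
    (fun x : U => Metric.ball (x : E) (r x)) (fun x => Metric.isOpen_ball)
  have hUeq : U = ⋃ x ∈ S, Metric.closedBall (x : E) (r x) := by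
    apply Subset.antisymm
    · intro y hy
      have : y ∈ ⋃ x : U, Metric.ball (x : E) (r x) :=
        mem_iUnion.2 ⟨⟨y, hy⟩, Metric.mem_ball_self (hr y hy)⟩
      rw [← hSU] at this
      simp only [mem_iUnion] at this ⊢
      obtain ⟨x, hx, h⟩ := this
      exact ⟨x, hx, Metric.ball_subset_closedBall h⟩
    · exact iUnion₂_subset fun x _ => hrU x x.2
  rw [hUeq, preimage_iUnion₂]
  refine MeasurableSet.biUnion hS fun x _ => (?_ : IsClosed _).measurableSet
  simpa [Metric.closedBall, dist_eq_norm, preimage] using hp.isClosed_norm_sub_le (x : E) (r x)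

end WeakContinuity

/-! ### The fundamental lemma of the calculus of variations -/

/-- The derivatives of test functions are exactly the test functions of mean zero. Subtracting a
multiple of a fixed bump `θ` of mass one brings any test function to mean zero, so `c` minus its
`θ`-average is orthogonal to all test functions. -/
theorem exists_eq_const_of_integral_deriv_mul_eq_zero {a b : ℝ} (hab : a < b) {c : ℝ → ℝ}
    (hc : Continuous c)
    (h : ∀ η : ℝ → ℝ, ContDiff ℝ ∞ η → HasCompactSupport η → tsupport η ⊆ Ioo a b →
      ∫ t, deriv η t * c t = 0) :
    ∃ k, ∀ t ∈ Icc a b, c t = k := by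
  set f : ContDiffBump ((a + b) / 2) :=
    ⟨(b - a) / 8, (b - a) / 4, by linarith, by linarith⟩ with hf
  set θ : ℝ → ℝ := f.normed volume with hθ
  have θsm : ContDiff ℝ ∞ θ := f.contDiff_normed
  have θint : ∫ t, θ t = 1 := f.integral_normed
  have θsupp : tsupport θ ⊆ Ioo a b := by
    rw [f.tsupport_normed_eq, Real.closedBall_eq_Icc]
    exact Icc_subset_Ioo (by simp [hf]; linarith) (by simp [hf]; linarith)
  have θc : HasCompactSupport θ := f.hasCompactSupport_normed
  set k := ∫ t, θ t * c t with hk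
  have key : ∀ᵐ x, x ∈ Ioo a b → (c x - k) = 0 := by
    refine isOpen_Ioo.ae_eq_zero_of_integral_contDiff_smul_eq_zero
      ((hc.sub continuous_const).locallyIntegrable.locallyIntegrableOn _) fun χ χsm χc χsupp => ?_
    set I := ∫ t, χ t with hI
    set g : ℝ → ℝ := fun t => χ t - I * θ t with hg
    have gsm : ContDiff ℝ ∞ g := χsm.sub (contDiff_const.mul θsm)
    have χi : Integrable χ := χsm.continuous.integrable_of_hasCompactSupport χc
    have θi : Integrable θ := θsm.continuous.integrable_of_hasCompactSupport θc
    have gint : ∫ t, g t = 0 := by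
      rw [hg, integral_sub χi (θi.const_mul _), integral_const_mul, θint, ← hI]; ring
    -- a compact interval in `(a, b)` carrying `g`
    obtain ⟨a', b', ha', hb', hgz⟩ : ∃ a' b', a < a' ∧ b' < b ∧ ∀ t, t ∉ Icc a' b' → g t = 0 := by
      have hK : IsCompact (tsupport χ ∪ tsupport θ) := IsCompact.union χc θc
      have hKs : tsupport χ ∪ tsupport θ ⊆ Ioo a b := union_subset χsupp θsupp
      have hne : (tsupport χ ∪ tsupport θ).Nonempty := by
        by_contra hne
        rw [not_nonempty_iff_eq_empty] at hne
        have : θ = 0 := by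
          rw [← tsupport_eq_empty_iff]
          exact (union_empty_iff.1 hne).2
        simp [this] at θint
      obtain ⟨a', ha', h1⟩ := hK.exists_isLeast hne
      obtain ⟨b', hb', h2⟩ := hK.exists_isGreatest hne
      refine ⟨a', b', (hKs ha').1, (hKs hb').2, fun t ht => ?_⟩
      have : t ∉ tsupport χ ∪ tsupport θ := fun h' => ht ⟨h1 h', h2 h'⟩
      simp only [mem_union, not_or] at this
      simp [hg, image_eq_zero_of_notMem_tsupport this.1, image_eq_zero_of_notMem_tsupport this.2]
    -- The primitive of `g` vanishes to the right of the support exactly because `g` has mean zero.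
    set η : ℝ → ℝ := fun t => ∫ s in a..t, g s with hη
    have ηd : ∀ t, HasDerivAt η (g t) t := hasDerivAt_integral_of_continuous gsm.continuous a
    have ηd' : deriv η = g := funext fun t => (ηd t).deriv
    have ηsm : ContDiff ℝ ∞ η := by
      rw [contDiff_infty_iff_deriv]
      exact ⟨fun t => (ηd t).differentiableAt, by rw [ηd']; exact gsm⟩
    have η0 : ∀ t, t ∉ Icc a' b' → η t = 0 := by
      intro t ht
      rw [mem_Icc, not_and_or, not_le, not_le] at ht
      rcases ht with ht | ht
      · refine intervalIntegral.integral_zero_ae (Eventually.of_forall fun s hs => hgz s ?_)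
        intro hs'
        rcases le_total a t with h' | h'
        · rw [uIoc_of_le h'] at hs
          linarith [hs.2, hs'.1]
        · rw [uIoc_of_ge h'] at hs
          linarith [hs.2, hs'.1]
      · rw [hη]
        have hs : Function.support g ⊆ Ioc a t := by
          intro s hs
          by_contra hs'
          refine hs (hgz s fun h' => hs' ⟨ha'.trans_le h'.1, h'.2.trans ht.le⟩)
        have := intervalIntegral.integral_eq_integral_of_support_subset (μ := volume) hs
        simp only [this, gint]
    have ηsupp : tsupport η ⊆ Icc a' b' := by
      refine closure_minimal (fun t ht => ?_) isClosed_Icc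
      by_contra h'
      exact ht (η0 t h')
    have := h η ηsm (isCompact_Icc.of_isClosed_subset (isClosed_tsupport _) ηsupp)
      (ηsupp.trans (Icc_subset_Ioo ha' hb'))
    rw [ηd'] at this
    have e1 : Integrable fun t => χ t * c t :=
      (χsm.continuous.mul hc).integrable_of_hasCompactSupport χc.mul_right
    have e2 : Integrable fun t => θ t * c t :=
      (θsm.continuous.mul hc).integrable_of_hasCompactSupport θc.mul_right
    have e3 : ∫ t, g t * c t = (∫ t, χ t * c t) - I * k := by
      rw [hk, ← integral_const_mul, ← integral_sub e1 (e2.const_mul _)]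
      congr 1; ext t; simp only [hg]; ring
    have e4 : ∫ t, χ t • (c t - k) = (∫ t, χ t * c t) - I * k := by
      rw [hI, ← integral_mul_const, ← integral_sub e1 (χi.mul_const _)]
      congr 1; ext t; simp only [smul_eq_mul]; ring
    rw [e4, ← e3, this]
  have hIoo : EqOn c (fun _ => k) (Ioo a b) := by
    have : (fun x => c x) =ᵐ[volume.restrict (Ioo a b)] fun _ => k := by
      filter_upwards [(ae_restrict_iff' measurableSet_Ioo).2 key] with x hx
      linarith
    exact Measure.eqOn_open_of_ae_eq this isOpen_Ioo hc.continuousOn continuousOn_const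
  refine ⟨k, ?_⟩
  have := hIoo.closure hc continuous_const
  rwa [closure_Ioo hab.ne] at this

/-- If `∫ η' p = ∫ η q` for all test functions `η`, then `p' = - q`. -/
theorem eq_sub_integral_of_integral_deriv_mul {T : ℝ} (hT : 0 < T) {p q : ℝ → ℝ}
    (hp : ContinuousOn p (Icc 0 T)) (hq : ContinuousOn q (Icc 0 T))
    (h : ∀ η : ℝ → ℝ, ContDiff ℝ ∞ η → HasCompactSupport η → tsupport η ⊆ Ioo 0 T →
      ∫ t in (0 : ℝ)..T, deriv η t * p t = ∫ t in (0 : ℝ)..T, η t * q t) :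
    ∀ t ∈ Icc 0 T, p t = p 0 - ∫ s in (0 : ℝ)..t, q s := by
  have clampcont : ∀ g : ℝ → ℝ, ContinuousOn g (Icc 0 T) → Continuous (clamp T g) := fun g hg =>
    hg.comp_continuous (f := fun t : ℝ => max 0 (min t T)) (by fun_prop) (clamp_mem hT.le)
  set p' := clamp T p
  set q' := clamp T q
  have hp' : Continuous p' := clampcont p hp
  have hq' : Continuous q' := clampcont q hq
  set Q : ℝ → ℝ := fun t => ∫ s in (0 : ℝ)..t, q' s with hQ
  have hQd : ∀ t, HasDerivAt Q (q' t) t := hasDerivAt_integral_of_continuous hq' 0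
  have hQc : Continuous Q := continuous_iff_continuousAt.2 fun t => (hQd t).continuousAt
  -- Moving the derivative from `η` onto `Q` turns the hypothesis into the statement that `p + ∫ q`
  -- has zero distributional derivative.
  obtain ⟨k, hk⟩ := exists_eq_const_of_integral_deriv_mul_eq_zero hT (c := fun t => p' t + Q t)
    (hp'.add hQc) (by
      intro η ηsm ηc ηs
      have ηd : ∀ t, HasDerivAt η (deriv η t) t := fun t =>
        (ηsm.differentiable (by simp) t).hasDerivAt
      have ηdc : Continuous (deriv η) := ηsm.continuous_deriv (by simp)
      have hout : ∀ t, t ∉ Ioo 0 T → η t = 0 := fun t ht =>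
        image_eq_zero_of_notMem_tsupport fun h' => ht (ηs h')
      have hs : Function.support (fun t => deriv η t * (p' t + Q t)) ⊆ Ioc 0 T := by
        intro t ht
        have h1 : t ∈ Function.support (deriv η) := fun h0 => ht (by simp [h0])
        exact Ioo_subset_Ioc_self (ηs (support_deriv_subset h1))
      rw [← intervalIntegral.integral_eq_integral_of_support_subset hs]
      have ibp := intervalIntegral.integral_mul_deriv_eq_deriv_mul (a := 0) (b := T)
        (fun t _ => hQd t) (fun t _ => ηd t) (hq'.intervalIntegrable _ _)
        (ηdc.intervalIntegrable _ _)
      rw [hout 0 (by simp), hout T (by simp)] at ibp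
      have e : ∀ t, deriv η t * (p' t + Q t) = deriv η t * p' t + Q t * deriv η t := fun t => by
        ring
      simp only [e]
      rw [intervalIntegral.integral_add
        (by apply Continuous.intervalIntegrable; fun_prop)
        (by apply Continuous.intervalIntegrable; fun_prop), ibp]
      have h1 : ∫ t in (0 : ℝ)..T, deriv η t * p' t = ∫ t in (0 : ℝ)..T, deriv η t * p t := by
        refine intervalIntegral.integral_congr fun t ht => ?_
        rw [uIcc_of_le hT.le] at ht
        simp only [p', clamp_of_mem p ht]
      have h2 : ∫ t in (0 : ℝ)..T, q' t * η t = ∫ t in (0 : ℝ)..T, η t * q t := by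
        refine intervalIntegral.integral_congr fun t ht => ?_
        rw [uIcc_of_le hT.le] at ht
        simp only [q', clamp_of_mem q ht]
        ring
      rw [h1, h2, h η ηsm ηc ηs]
      ring)
  intro t ht
  have h0 := hk 0 ⟨le_rfl, hT.le⟩
  have h1 := hk t ht
  have h2 : Q t = ∫ s in (0 : ℝ)..t, q s := by
    refine intervalIntegral.integral_congr fun s hs => ?_
    rw [uIcc_of_le ht.1] at hs
    simp only [q', clamp_of_mem q ⟨hs.1, hs.2.trans ht.2⟩]
  have h3 : Q 0 = 0 := by simp [hQ]
  simp only [h3, h2, p', clamp_of_mem p ht, clamp_of_mem p (left_mem_Icc.2 hT.le)] at h0 h1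
  linarith

theorem integral_integral_swap_of_continuous {f : ℝ → ℝ → ℝ}
    (hf : Continuous (Function.uncurry f)) {a b c d : ℝ} (hab : a ≤ b) (hcd : c ≤ d) :
    ∫ x in a..b, ∫ y in c..d, f x y = ∫ y in c..d, ∫ x in a..b, f x y := by
  simp only [intervalIntegral.integral_of_le hab, intervalIntegral.integral_of_le hcd]
  refine integral_integral_swap ?_
  rw [Measure.prod_restrict]
  exact ((hf.continuousOn (s := Icc a b ×ˢ Icc c d)).integrableOn_compact
    (isCompact_Icc.prod isCompact_Icc)).mono_set
      (prod_mono Ioc_subset_Icc_self Ioc_subset_Icc_self)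

/-! ### Positive type: kernels smooth up to lag zero. -/

section Kernel

variable {X : Type*} [NormedAddCommGroup X] [InnerProductSpace ℝ X]

/-- Symmetry merges the two terms containing `y'`, so `⟪G y, y'⟫` becomes half an exact derivative
up to the `G'` term. -/
theorem HasDerivAt.inner_clm_self {G : ℝ → X →L[ℝ] X} {G' : X →L[ℝ] X} {y : ℝ → X} {y' : X}
    {t : ℝ} (hG : HasDerivAt G G' t) (hy : HasDerivAt y y' t)
    (hsymm : ∀ a b, ⟪G t a, b⟫ = ⟪G t b, a⟫) :
    HasDerivAt (fun t => ⟪G t (y t), y t⟫) (⟪G' (y t), y t⟫ + 2 * ⟪G t (y t), y'⟫) t := by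
  have h := (hG.clm_apply hy).inner ℝ hy
  have e : ⟪G t (y t), y'⟫ + ⟪G' (y t) + G t y', y t⟫
      = ⟪G' (y t), y t⟫ + 2 * ⟪G t (y t), y'⟫ := by
    rw [inner_add_left, hsymm y' (y t)]
    ring
  rwa [e] at h

variable [CompleteSpace X]

/-- Smooth non-negative, non-increasing, convex kernels are of positive type. -/
theorem integral_kernel_nonneg_of_smooth {T : ℝ} (hT : 0 ≤ T) {G G₁ G₂ : ℝ → X →L[ℝ] X}
    (hG : ∀ s ∈ Icc 0 T, HasDerivAt G (G₁ s) s) (hG₁ : ∀ s ∈ Icc 0 T, HasDerivAt G₁ (G₂ s) s)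
    (hG₂ : ContinuousOn G₂ (Icc 0 T))
    (hGs : ∀ a b, ⟪G T a, b⟫ = ⟪G T b, a⟫)
    (hG₁s : ∀ s ∈ Icc 0 T, ∀ a b, ⟪G₁ s a, b⟫ = ⟪G₁ s b, a⟫)
    (hG0 : ∀ a, 0 ≤ ⟪G T a, a⟫)
    (hG₁0 : ∀ s ∈ Icc 0 T, ∀ a, ⟪G₁ s a, a⟫ ≤ 0)
    (hG₂0 : ∀ s ∈ Icc 0 T, ∀ a, 0 ≤ ⟪G₂ s a, a⟫)
    {e : ℝ → X} (he : Continuous e) (he0 : ∀ t ≤ 0, e t = 0) {σ : ℝ} (hσ : σ ∈ Icc 0 T) :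
    0 ≤ ∫ t in (0 : ℝ)..σ, ∫ s in (0 : ℝ)..T, ⟪G s (e (t - s)), e t⟫ := by
  set E : ℝ → X := fun t => ∫ r in (0 : ℝ)..t, e r with hE
  have hEd : ∀ t, HasDerivAt E (e t) t := hasDerivAt_integral_of_continuous he 0
  have hEc : Continuous E := continuous_iff_continuousAt.2 fun t => (hEd t).continuousAt
  have hE0 : ∀ t ≤ 0, E t = 0 := by
    intro t ht
    rw [hE]
    simp only
    rw [intervalIntegral.integral_congr (g := fun _ => (0 : X))]
    · simp
    · intro r hr
      rw [uIcc_of_ge ht] at hr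
      exact he0 r hr.2
  have hGc : ContinuousOn G (Icc 0 T) := fun s hs => (hG s hs).continuousAt.continuousWithinAt
  have hG₁c : ContinuousOn G₁ (Icc 0 T) := fun s hs => (hG₁ s hs).continuousAt.continuousWithinAt
  have hcl : ∀ {K : ℝ → X →L[ℝ] X}, ContinuousOn K (Icc 0 T) → Continuous (clamp T K) :=
    fun hK => hK.comp_continuous (f := fun t : ℝ => max 0 (min t T)) (by fun_prop) (clamp_mem hT)
  -- `D t s` is the integral of `e` over `(t - s, t)`. Since `∂ₛD = e (t - s)` and `∂ₜD = e t - e (t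
  -- - s)`, it serves as a primitive in the lag `s`, and it pairs with its own time derivative once
  -- `e (t - s)` is subtracted from `e t`.
  set D : ℝ → ℝ → X := fun t s => E t - E (t - s) with hD
  have hDs : ∀ t s, HasDerivAt (D t) (e (t - s)) s := by
    intro t s
    have := ((hEd (t - s)).scomp s ((hasDerivAt_id s).const_sub t)).const_sub (E t)
    simpa using this
  have hDt : ∀ t s, HasDerivAt (fun t => D t s) (e t - e (t - s)) t := by
    intro t s
    have := (hEd t).sub ((hEd (t - s)).scomp t ((hasDerivAt_id t).sub_const s))
    rw [one_smul] at this
    exact this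
  have hDc : Continuous (Function.uncurry D) := by
    simp only [hD, Function.uncurry_def]; fun_prop
  have hDc' : ∀ t, Continuous (D t) := fun t => by simp only [hD]; fun_prop
  -- integration by parts in `s`
  have key : ∀ t ∈ Icc 0 T, ⟪G T (E t), e t⟫
      - ∫ s in (0 : ℝ)..T, ⟪clamp T G₁ s (D t s), e t - e (t - s)⟫
      ≤ ∫ s in (0 : ℝ)..T, ⟪G s (e (t - s)), e t⟫ := by
    intro t ht
    -- Here `t ≤ T`, so `t - T` lies in the past, where `E` vanishes.
    have hDT : D t T = E t := by
      simp only [hD]; rw [hE0 (t - T) (by linarith [ht.2])]; simp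
    have hD0 : D t 0 = 0 := by simp [hD]
    have ic1 : IntervalIntegrable (fun s => ⟪G₁ s (D t s), e t⟫) volume 0 T := by
      apply ContinuousOn.intervalIntegrable
      rw [uIcc_of_le hT]
      exact (hG₁c.clm_apply (hDc' t).continuousOn).inner continuousOn_const
    have ic2 : IntervalIntegrable (fun s => ⟪G s (e (t - s)), e t⟫) volume 0 T := by
      apply ContinuousOn.intervalIntegrable
      rw [uIcc_of_le hT]
      exact (hGc.clm_apply (g := fun s => e (t - s)) (by fun_prop)).inner continuousOn_const
    have ic3 : IntervalIntegrable (fun s => ⟪G₂ s (D t s), D t s⟫) volume 0 T := by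
      apply ContinuousOn.intervalIntegrable
      rw [uIcc_of_le hT]
      exact (hG₂.clm_apply (hDc' t).continuousOn).inner (hDc' t).continuousOn
    have ic4 : IntervalIntegrable (fun s => ⟪G₁ s (D t s), e (t - s)⟫) volume 0 T := by
      apply ContinuousOn.intervalIntegrable
      rw [uIcc_of_le hT]
      exact (hG₁c.clm_apply (hDc' t).continuousOn).inner (by fun_prop)
    have h1 := intervalIntegral.integral_eq_sub_of_hasDerivAt (a := 0) (b := T)
      (f := fun s => ⟪G s (D t s), e t⟫)
      (f' := fun s => ⟪G₁ s (D t s), e t⟫ + ⟪G s (e (t - s)), e t⟫) (by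
        intro s hs
        rw [uIcc_of_le hT] at hs
        have := ((hG s hs).clm_apply (hDs t s)).inner ℝ (hasDerivAt_const s (e t))
        simpa [inner_add_left] using this) (ic1.add ic2)
    rw [intervalIntegral.integral_add ic1 ic2, hDT, hD0] at h1
    -- Second integration by parts: `2 ∫ ⟪G₁ D, e (t - s)⟫` equals `⟪G₁ T (E t), E t⟫ - ∫ ⟪G₂ D,
    -- D⟫`, which is non-positive by monotonicity and convexity. Dropping it gives the inequality.
    have h2 := intervalIntegral.integral_eq_sub_of_hasDerivAt (a := 0) (b := T)
      (f := fun s => ⟪G₁ s (D t s), D t s⟫)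
      (f' := fun s => ⟪G₂ s (D t s), D t s⟫ + 2 * ⟪G₁ s (D t s), e (t - s)⟫) (by
        intro s hs
        rw [uIcc_of_le hT] at hs
        exact HasDerivAt.inner_clm_self (hG₁ s hs) (hDs t s) (hG₁s s hs)) (ic3.add (ic4.const_mul 2))
    rw [intervalIntegral.integral_add ic3 (ic4.const_mul 2), hDT, hD0,
      intervalIntegral.integral_const_mul] at h2
    have h3 : 0 ≤ ∫ s in (0 : ℝ)..T, ⟪G₂ s (D t s), D t s⟫ :=
      intervalIntegral.integral_nonneg hT fun s hs => hG₂0 s hs _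
    have h4 := hG₁0 T ⟨hT, le_rfl⟩ (E t)
    have h5 : ∫ s in (0 : ℝ)..T, ⟪clamp T G₁ s (D t s), e t - e (t - s)⟫
        = (∫ s in (0 : ℝ)..T, ⟪G₁ s (D t s), e t⟫)
          - ∫ s in (0 : ℝ)..T, ⟪G₁ s (D t s), e (t - s)⟫ := by
      rw [← intervalIntegral.integral_sub ic1 ic4]
      refine intervalIntegral.integral_congr fun s hs => ?_
      rw [uIcc_of_le hT] at hs
      simp only [clamp_of_mem G₁ hs, inner_sub_right]
    simp only [map_zero, inner_zero_left] at h1 h2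
    linarith
  -- the continuous integrands
  have jc : Continuous (Function.uncurry fun t s => ⟪clamp T G₁ s (D t s), e t - e (t - s)⟫) := by
    have := hcl hG₁c
    have h1 : Continuous fun p : ℝ × ℝ => clamp T G₁ p.2 (D p.1 p.2) :=
      (this.comp continuous_snd).clm_apply hDc
    simp only [Function.uncurry_def]
    exact h1.inner (by fun_prop)
  have kc : Continuous fun t => ∫ s in (0 : ℝ)..T, ⟪G s (e (t - s)), e t⟫ := by
    have : (fun t => ∫ s in (0 : ℝ)..T, ⟪G s (e (t - s)), e t⟫)
        = fun t => ∫ s in (0 : ℝ)..T, ⟪clamp T G s (e (t - s)), e t⟫ := by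
      ext t
      refine intervalIntegral.integral_congr fun s hs => ?_
      rw [uIcc_of_le hT] at hs
      simp only [clamp_of_mem G hs]
    rw [this]
    apply intervalIntegral.continuous_parametric_intervalIntegral_of_continuous'
    simp only [Function.uncurry_def]
    have h1 : Continuous fun p : ℝ × ℝ => clamp T G p.2 (e (p.1 - p.2)) :=
      ((hcl hGc).comp continuous_snd).clm_apply (by fun_prop)
    exact h1.inner (by fun_prop)
  have mc : Continuous fun t => ∫ s in (0 : ℝ)..T, ⟪clamp T G₁ s (D t s), e t - e (t - s)⟫ :=
    intervalIntegral.continuous_parametric_intervalIntegral_of_continuous' jc _ _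
  have gc : Continuous fun t => ⟪G T (E t), e t⟫ := by fun_prop
  have hle := intervalIntegral.integral_mono_on hσ.1
    ((gc.sub mc).intervalIntegrable (μ := volume) 0 σ) (kc.intervalIntegrable 0 σ)
    (fun t ht => key t ⟨ht.1, ht.2.trans hσ.2⟩)
  refine le_trans ?_ hle
  simp only [Pi.sub_apply]
  rw [intervalIntegral.integral_sub (gc.intervalIntegrable _ _) (mc.intervalIntegrable _ _),
    integral_integral_swap_of_continuous jc hσ.1 hT]
  have h1 : ∫ t in (0 : ℝ)..σ, ⟪G T (E t), e t⟫ = ⟪G T (E σ), E σ⟫ / 2 := by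
    rw [intervalIntegral.integral_eq_sub_of_hasDerivAt (f := fun t => ⟪G T (E t), E t⟫ / 2)
      (fun t _ => ?_) (gc.intervalIntegrable _ _)]
    · simp [hE0 0 le_rfl]
    · have := (HasDerivAt.inner_clm_self (hasDerivAt_const t (G T)) (hEd t) hGs).div_const 2
      simpa using this
  -- For fixed `s` the integrand is `⟪G₁ s D, ∂ₜD⟫`, the time derivative of `⟪G₁ s D, D⟫ / 2`, and
  -- `D 0 s = 0`. This is why the time integral is taken inside.
  have h2 : ∀ s ∈ Icc 0 T, ∫ t in (0 : ℝ)..σ, ⟪clamp T G₁ s (D t s), e t - e (t - s)⟫ ≤ 0 := by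
    intro s hs
    rw [clamp_of_mem G₁ hs]
    rw [intervalIntegral.integral_eq_sub_of_hasDerivAt
      (f := fun t => ⟪G₁ s (D t s), D t s⟫ / 2)]
    · have : D 0 s = 0 := by simp [hD, hE0 0 le_rfl, hE0 (-s) (by linarith [hs.1])]
      rw [this]
      simp only [map_zero, inner_zero_left]
      linarith [hG₁0 s hs (D σ s)]
    · intro t _
      have := (HasDerivAt.inner_clm_self (hasDerivAt_const t (G₁ s)) (hDt t s)
        (hG₁s s hs)).div_const 2
      simpa using this
    · apply Continuous.intervalIntegrable
      have := hDc.comp (Continuous.prodMk_left s)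
      simp only [hD]
      fun_prop
  have h3 : ∫ s in (0 : ℝ)..T, ∫ t in (0 : ℝ)..σ, ⟪clamp T G₁ s (D t s), e t - e (t - s)⟫ ≤ 0 := by
    rw [← neg_nonneg, ← intervalIntegral.integral_neg]
    exact intervalIntegral.integral_nonneg hT fun s hs => neg_nonneg.2 (h2 s hs)
  have := hG0 (E σ)
  linarith

end Kernel

theorem intervalIntegrable_of_bounded {E : Type*} [NormedAddCommGroup E] {p : ℝ → E} {M : ℝ}
    (hp : StronglyMeasurable p) (hM : ∀ t, ‖p t‖ ≤ M) (a b : ℝ) :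
    IntervalIntegrable p volume a b := by
  rw [intervalIntegrable_iff]
  exact (intervalIntegrable_iff.1 (intervalIntegrable_const (c := M))).mono'
    hp.aestronglyMeasurable (Eventually.of_forall hM)

/-! ### Convolution with an integrable operator kernel. -/

section Convolution

variable {X : Type*} [NormedAddCommGroup X] [NormedSpace ℝ X]

/-- The convolution `t ↦ ∫₀ᵀ G(s) p(t - s) ds` of an operator-valued kernel on `(0,T)` with `p`. -/
noncomputable def conv (T : ℝ) (G : ℝ → X →L[ℝ] X) (p : ℝ → X) (t : ℝ) : X :=
  ∫ s in (0 : ℝ)..T, G s (p (t - s))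

theorem conv_congr {T : ℝ} (hT : 0 ≤ T) {G : ℝ → X →L[ℝ] X} {p q : ℝ → X} {t : ℝ}
    (h : ∀ r ≤ t, p r = q r) : conv T G p t = conv T G q t := by
  refine intervalIntegral.integral_congr fun s hs => ?_
  rw [uIcc_of_le hT] at hs
  simp only [h (t - s) (by linarith [hs.1])]

variable {T : ℝ} {G : ℝ → X →L[ℝ] X} {p : ℝ → X} {M : ℝ}

theorem intervalIntegrable_conv (hG : IntervalIntegrable G volume 0 T) (hp : StronglyMeasurable p)
    (hM : ∀ t, ‖p t‖ ≤ M) (t : ℝ) :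
    IntervalIntegrable (fun s => G s (p (t - s))) volume 0 T := by
  rw [intervalIntegrable_iff] at hG ⊢
  refine (hG.norm.mul_const M).mono' ?_ (Eventually.of_forall fun s => ?_)
  · exact (ContinuousLinearMap.id ℝ (X →L[ℝ] X)).aestronglyMeasurable_comp₂
      hG.aestronglyMeasurable
      (hp.comp_measurable (measurable_const.sub measurable_id)).aestronglyMeasurable
  · exact ((G s).le_opNorm _).trans (by gcongr; exact hM _)

theorem integrableOn_prod_conv (hG : IntervalIntegrable G volume 0 T) (hp : StronglyMeasurable p)
    (hM : ∀ t, ‖p t‖ ≤ M) (a b : ℝ) :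
    IntegrableOn (Function.uncurry fun s t => G s (p (t - s))) (uIoc 0 T ×ˢ uIoc a b) := by
  rw [intervalIntegrable_iff] at hG
  rw [IntegrableOn, Measure.volume_eq_prod, ← Measure.prod_restrict]
  have h1 : Integrable (fun z : ℝ × ℝ => ‖G z.1‖ * M)
      ((volume.restrict (uIoc 0 T)).prod (volume.restrict (uIoc a b))) :=
    hG.norm.mul_prod (intervalIntegrable_iff.1 intervalIntegrable_const)
  refine h1.mono' ?_ (Eventually.of_forall fun z => ?_)
  · exact (ContinuousLinearMap.id ℝ (X →L[ℝ] X)).aestronglyMeasurable_comp₂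
      hG.aestronglyMeasurable.comp_fst
      (hp.comp_measurable (measurable_snd.sub measurable_fst)).aestronglyMeasurable
  · exact ((G z.1).le_opNorm _).trans (by gcongr; exact hM _)

theorem continuous_conv (hG : IntervalIntegrable G volume 0 T) (hp : Continuous p)
    (hM : ∀ t, ‖p t‖ ≤ M) (hpm : StronglyMeasurable p) : Continuous (conv T G p) := by
  refine intervalIntegral.continuous_of_dominated_interval
    (bound := fun s => ‖G s‖ * M) (fun t => ?_) (fun t => ?_) ?_ ?_
  · exact (intervalIntegrable_iff.1 (intervalIntegrable_conv hG hpm hM t)).aestronglyMeasurable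
  · exact Eventually.of_forall fun s _ => ((G s).le_opNorm _).trans (by gcongr; exact hM _)
  · exact hG.norm.mul_const M
  · exact Eventually.of_forall fun s _ => by fun_prop

theorem norm_conv_le (hT : 0 ≤ T) (hG : IntervalIntegrable G volume 0 T)
    (hM : ∀ t, ‖p t‖ ≤ M) (t : ℝ) : ‖conv T G p t‖ ≤ ∫ s in (0 : ℝ)..T, ‖G s‖ * M :=
  intervalIntegral.norm_integral_le_of_norm_le hT
    (Eventually.of_forall fun s _ => ((G s).le_opNorm _).trans (by gcongr; exact hM _))
    (hG.norm.mul_const _)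

variable [CompleteSpace X]

theorem clm_conv (hG : IntervalIntegrable G volume 0 T) (hp : StronglyMeasurable p)
    (hM : ∀ t, ‖p t‖ ≤ M) {F : Type*} [NormedAddCommGroup F] [NormedSpace ℝ F] [CompleteSpace F]
    (ℓ : X →L[ℝ] F) (t : ℝ) :
    ℓ (conv T G p t) = ∫ s in (0 : ℝ)..T, ℓ (G s (p (t - s))) :=
  (ℓ.intervalIntegral_comp_comm (intervalIntegrable_conv hG hp hM t)).symm

/-- For each lag `s`, `ℓ ∘ G s` is again a continuous functional, so the integrand is continuous in
`t`. Dominated convergence does the rest. -/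
theorem WeakCont.conv (hG : IntervalIntegrable G volume 0 T) (hp : StronglyMeasurable p)
    (hpw : WeakCont p) (hM : ∀ t, ‖p t‖ ≤ M) : WeakCont (conv T G p) := by
  intro ℓ
  simp only [clm_conv hG hp hM ℓ]
  refine intervalIntegral.continuous_of_dominated_interval
    (bound := fun s => ‖ℓ‖ * (‖G s‖ * M)) (fun t => ?_) (fun t => ?_) ?_ ?_
  · exact ℓ.continuous.comp_aestronglyMeasurable
      (intervalIntegrable_iff.1 (intervalIntegrable_conv hG hp hM t)).aestronglyMeasurable
  · refine Eventually.of_forall fun s _ => (ℓ.le_opNorm _).trans ?_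
    gcongr
    exact ((G s).le_opNorm _).trans (by gcongr; exact hM _)
  · exact (hG.norm.mul_const M).const_mul ‖ℓ‖
  · exact Eventually.of_forall fun s _ =>
      (hpw (ℓ.comp (G s))).comp (continuous_id.sub continuous_const)

/-- The primitive of a convolution is the convolution with the primitive. -/
theorem conv_integral (hT : 0 ≤ T) (hG : IntervalIntegrable G volume 0 T)
    (hp : StronglyMeasurable p) (hM : ∀ t, ‖p t‖ ≤ M) (hp0 : ∀ t ≤ 0, p t = 0) (t : ℝ) :
    conv T G (fun t => ∫ r in (0 : ℝ)..t, p r) t = ∫ τ in (0 : ℝ)..t, conv T G p τ := by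
  have hpi : ∀ a b, IntervalIntegrable p volume a b := intervalIntegrable_of_bounded hp hM
  simp only [conv]
  rw [← intervalIntegral_intervalIntegral_swap (integrableOn_prod_conv hG hp hM 0 t)]
  refine intervalIntegral.integral_congr fun s hs => ?_
  rw [uIcc_of_le hT] at hs
  -- After the shift the inner integral of `p` starts at `-s`. The piece over `(-s, 0)` vanishes
  -- because `p` is zero in the past.
  rw [(G s).intervalIntegral_comp_comm, intervalIntegral.integral_comp_sub_right, zero_sub,
    ← intervalIntegral.integral_add_adjacent_intervals (hpi (-s) 0) (hpi 0 (t - s))]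
  · rw [intervalIntegral.integral_congr (a := -s) (b := 0) (g := fun _ => (0 : X))]
    · simp
    · intro r hr
      rw [uIcc_of_le (by linarith [hs.1])] at hr
      exact hp0 r hr.2
  · have := (hpi (0 - s) (t - s)).comp_sub_right s
    simpa using this

end Convolution

/-! ### Positive type: kernels singular at lag zero. -/

section Positivity

variable {X : Type*} [NormedAddCommGroup X] [InnerProductSpace ℝ X]

/-- Expand the form at `x + y` and `x - y`. Monotonicity of the kernel controls only quadratic
forms, and this transfers the control to the bilinear form. -/
theorem abs_inner_clm_le {A : X →L[ℝ] X} (hs : ∀ a b, ⟪A a, b⟫ = ⟪A b, a⟫)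
    (h0 : ∀ a, 0 ≤ ⟪A a, a⟫) (x y : X) : |⟪A x, y⟫| ≤ (⟪A x, x⟫ + ⟪A y, y⟫) / 2 := by
  have h1 := h0 (x + y)
  have h2 := h0 (x - y)
  simp only [map_add, map_sub, inner_add_left, inner_add_right, inner_sub_left,
    inner_sub_right, hs y x] at h1 h2
  rw [abs_le]
  constructor <;> linarith

theorem hasDerivAt_inner_clm {G : ℝ → X →L[ℝ] X} {G' : X →L[ℝ] X} {t : ℝ}
    (hG : HasDerivAt G G' t) (a b : X) : HasDerivAt (fun t => ⟪G t a, b⟫) ⟪G' a, b⟫ t := by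
  have := (hG.clm_apply (hasDerivAt_const t a)).inner ℝ (hasDerivAt_const t b)
  simpa using this

variable [CompleteSpace X]

/-- Non-negative, non-increasing, convex kernels, integrable up to a singularity at `0`, are of
positive type. -/
theorem integral_conv_nonneg {T δ : ℝ} (hT : 0 < T) (hδ : 0 < δ) {G : ℝ → X →L[ℝ] X}
    (hG : ContDiffOn ℝ 2 G (Ioo 0 (T + δ))) (hGi : IntervalIntegrable G volume 0 T)
    (hGs : ∀ s ∈ Ioo 0 (T + δ), ∀ a b, ⟪G s a, b⟫ = ⟪G s b, a⟫)
    (hG0 : ∀ s ∈ Ioo 0 (T + δ), ∀ a, 0 ≤ ⟪G s a, a⟫)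
    (hG₁0 : ∀ s ∈ Ioo 0 (T + δ), ∀ a, ⟪deriv G s a, a⟫ ≤ 0)
    (hG₂0 : ∀ s ∈ Ioo 0 (T + δ), ∀ a, 0 ≤ ⟪deriv (deriv G) s a, a⟫)
    {e : ℝ → X} (he : Continuous e) (hem : StronglyMeasurable e) {M : ℝ} (hM : ∀ t, ‖e t‖ ≤ M)
    (he0 : ∀ t ≤ 0, e t = 0) {σ : ℝ} (hσ : σ ∈ Icc 0 T) :
    0 ≤ ∫ t in (0 : ℝ)..σ, ⟪conv T G e t, e t⟫ := by
  have hd1 : ∀ s ∈ Ioo 0 (T + δ), HasDerivAt G (deriv G s) s := fun s hs =>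
    ((hG.differentiableOn (by simp)).differentiableAt (isOpen_Ioo.mem_nhds hs)).hasDerivAt
  have hdc : ContDiffOn ℝ 1 (deriv G) (Ioo 0 (T + δ)) :=
    ((contDiffOn_succ_iff_deriv_of_isOpen (n := 1) isOpen_Ioo).1 hG).2.2
  have hd2 : ∀ s ∈ Ioo 0 (T + δ), HasDerivAt (deriv G) (deriv (deriv G) s) s := fun s hs =>
    ((hdc.differentiableOn (by simp)).differentiableAt (isOpen_Ioo.mem_nhds hs)).hasDerivAt
  have hd2c : ContinuousOn (deriv (deriv G)) (Ioo 0 (T + δ)) :=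
    hdc.continuousOn_deriv_of_isOpen isOpen_Ioo (by simp)
  have hG₁s : ∀ s ∈ Ioo 0 (T + δ), ∀ a b, ⟪deriv G s a, b⟫ = ⟪deriv G s b, a⟫ := by
    intro s hs a b
    have h1 := hasDerivAt_inner_clm (hd1 s hs) a b
    have h2 := hasDerivAt_inner_clm (hd1 s hs) b a
    refine h1.unique (h2.congr_of_eventuallyEq ?_)
    filter_upwards [isOpen_Ioo.mem_nhds hs] with r hr using hGs r hr a b
  have hanti : ∀ a, AntitoneOn (fun s => ⟪G s a, a⟫) (Ioo 0 (T + δ)) := by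
    intro a
    refine antitoneOn_of_deriv_nonpos (convex_Ioo _ _)
      (fun s hs => (hasDerivAt_inner_clm (hd1 s hs) a a).continuousAt.continuousWithinAt) ?_ ?_
    · rw [interior_Ioo]
      exact fun s hs =>
        (hasDerivAt_inner_clm (hd1 s hs) a a).differentiableAt.differentiableWithinAt
    · rw [interior_Ioo]
      intro s hs
      rw [(hasDerivAt_inner_clm (hd1 s hs) a a).deriv]
      exact hG₁0 s hs a
  have hM0 : 0 ≤ M := (norm_nonneg _).trans (hM 0)
  -- the shifted kernels are dominated by the original one
  have hbd : ∀ ε ∈ Ioo 0 δ, ∀ s ∈ Ioc 0 T, ∀ r t,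
      ‖⟪G (s + ε) (e r), e t⟫‖ ≤ ‖G s‖ * M ^ 2 := by
    intro ε hε s hs r t
    have m1 : s ∈ Ioo 0 (T + δ) := ⟨hs.1, by linarith [hs.2]⟩
    have m2 : s + ε ∈ Ioo 0 (T + δ) := ⟨by linarith [hs.1, hε.1], by linarith [hs.2, hε.2]⟩
    have hq : ∀ τ, ⟪G (s + ε) (e τ), e τ⟫ ≤ ‖G s‖ * M ^ 2 := by
      intro τ
      have h1 := hanti (e τ) m1 m2 (by linarith [hε.1])
      refine h1.trans ((real_inner_le_norm _ _).trans ?_)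
      have h2 := (G s).le_opNorm (e τ)
      calc ‖G s (e τ)‖ * ‖e τ‖ ≤ (‖G s‖ * M) * M := by
            gcongr
            · exact h2.trans (by gcongr; exact hM _)
            · exact hM _
        _ = _ := by ring
    have := abs_inner_clm_le (hGs _ m2) (hG0 _ m2) (e r) (e t)
    rw [Real.norm_eq_abs]
    linarith [hq r, hq t]
  have hcontG : ContinuousOn G (Ioo 0 (T + δ)) := hG.continuousOn
  have hshift : ∀ ε ∈ Ioo 0 δ, ContinuousOn (fun s => G (s + ε)) (Icc 0 T) := fun ε hε =>
    hcontG.comp (by fun_prop) fun s hs => ⟨by linarith [hs.1, hε.1], by linarith [hs.2, hε.2]⟩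
  have hev : ∀ᶠ ε in 𝓝[>] (0 : ℝ), ε ∈ Ioo 0 δ := Ioo_mem_nhdsGT hδ
  have hi : ∀ t, ⟪conv T G e t, e t⟫ = ∫ s in (0 : ℝ)..T, ⟪G s (e (t - s)), e t⟫ := fun t => by
    have := clm_conv hGi hem hM (innerSL ℝ (e t)) t
    simpa [real_inner_comm] using this
  have hinner : ∀ t, Tendsto (fun ε => ∫ s in (0 : ℝ)..T, ⟪G (s + ε) (e (t - s)), e t⟫) (𝓝[>] 0)
      (𝓝 ⟪conv T G e t, e t⟫) := by
    intro t
    rw [hi t]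
    refine intervalIntegral.tendsto_integral_filter_of_dominated_convergence
      (fun s => ‖G s‖ * M ^ 2) ?_ ?_ (hGi.norm.mul_const _) ?_
    · filter_upwards [hev] with ε hε
      rw [uIoc_of_le hT.le]
      refine ContinuousOn.aestronglyMeasurable ?_ measurableSet_Ioc
      exact (((hshift ε hε).clm_apply (g := fun s => e (t - s)) (by fun_prop)).inner
        continuousOn_const).mono Ioc_subset_Icc_self
    · filter_upwards [hev] with ε hε
      refine Eventually.of_forall fun s hs => ?_
      rw [uIoc_of_le hT.le] at hs
      exact hbd ε hε s hs _ _
    · refine Eventually.of_forall fun s hs => ?_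
      rw [uIoc_of_le hT.le] at hs
      have hc : ContinuousAt G s :=
        hcontG.continuousAt (Ioo_mem_nhds hs.1 (by linarith [hs.2]))
      have h1 : Tendsto (fun ε => G (s + ε)) (𝓝[>] 0) (𝓝 (G s)) := by
        have h2 : Tendsto (fun ε : ℝ => s + ε) (𝓝 0) (𝓝 s) := by
          have : Continuous fun ε : ℝ => s + ε := by fun_prop
          simpa using this.tendsto 0
        exact (hc.tendsto.comp h2).mono_left nhdsWithin_le_nhds
      exact (((ContinuousLinearMap.apply ℝ X (e (t - s))).continuous.tendsto _).comp h1).inner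
        tendsto_const_nhds
  have houter : Tendsto (fun ε => ∫ t in (0 : ℝ)..σ, ∫ s in (0 : ℝ)..T,
      ⟪G (s + ε) (e (t - s)), e t⟫) (𝓝[>] 0) (𝓝 (∫ t in (0 : ℝ)..σ, ⟪conv T G e t, e t⟫)) := by
    refine intervalIntegral.tendsto_integral_filter_of_dominated_convergence
      (fun _ => ∫ s in (0 : ℝ)..T, ‖G s‖ * M ^ 2) ?_ ?_ intervalIntegrable_const ?_
    · filter_upwards [hev] with ε hε
      have hci : IntervalIntegrable (fun s => G (s + ε)) volume 0 T :=
        (hshift ε hε).intervalIntegrable_of_Icc hT.le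
      have : (fun t => ∫ s in (0 : ℝ)..T, ⟪G (s + ε) (e (t - s)), e t⟫)
          = fun t => ⟪conv T (fun s => G (s + ε)) e t, e t⟫ := by
        ext t
        have := clm_conv hci hem hM (innerSL ℝ (e t)) t
        simpa [real_inner_comm] using this.symm
      rw [this]
      exact ((continuous_conv hci he hM hem).inner he).aestronglyMeasurable
    · filter_upwards [hev] with ε hε
      refine Eventually.of_forall fun t _ => ?_
      refine intervalIntegral.norm_integral_le_of_norm_le hT.le
        (Eventually.of_forall fun s hs => hbd ε hε s hs _ _) (hGi.norm.mul_const _)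
    · exact Eventually.of_forall fun t _ => hinner t
  -- For `0 < ε < δ` the shifted kernel is `C²` on a neighbourhood of the whole interval `[0,T]`, so
  -- the smooth case applies.
  refine ge_of_tendsto houter ?_
  filter_upwards [hev] with ε hε
  have hm : ∀ s ∈ Icc 0 T, s + ε ∈ Ioo 0 (T + δ) := fun s hs =>
    ⟨by linarith [hs.1, hε.1], by linarith [hs.2, hε.2]⟩
  have hTm : T ∈ Icc 0 T := ⟨hT.le, le_rfl⟩
  exact integral_kernel_nonneg_of_smooth (G := fun s => G (s + ε))
    (G₁ := fun s => deriv G (s + ε)) (G₂ := fun s => deriv (deriv G) (s + ε)) hT.le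
    (fun s hs => (hd1 _ (hm s hs)).comp_add_const s ε)
    (fun s hs => (hd2 _ (hm s hs)).comp_add_const s ε)
    (hd2c.comp (by fun_prop) hm) (hGs _ (hm T hTm)) (fun s hs => hG₁s _ (hm s hs))
    (hG0 _ (hm T hTm)) (fun s hs => hG₁0 _ (hm s hs)) (fun s hs => hG₂0 _ (hm s hs)) he he0 hσ

end Positivity

theorem integral_inner_left {E : Type*} [NormedAddCommGroup E] [InnerProductSpace ℝ E]
    [CompleteSpace E] {p : ℝ → E} {a b : ℝ} (hp : IntervalIntegrable p volume a b) (c : E) :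
    ∫ t in a..b, ⟪p t, c⟫ = ⟪∫ t in a..b, p t, c⟫ := by
  have := (innerSL ℝ c).intervalIntegral_comp_comm hp
  simpa [real_inner_comm] using this

theorem continuous_primitive_of_bounded {E : Type*} [NormedAddCommGroup E] [NormedSpace ℝ E]
    {p : ℝ → E} {M : ℝ} (hp : StronglyMeasurable p) (hM : ∀ t, ‖p t‖ ≤ M) :
    Continuous fun t => ∫ s in (0 : ℝ)..t, p s :=
  intervalIntegral.continuous_primitive (intervalIntegrable_of_bounded hp hM) 0

/-- A weakly continuous function whose weak derivative is bounded is norm continuous. -/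
theorem continuous_clamp_of_inner_eq_integral {H : Type*} [NormedAddCommGroup H]
    [InnerProductSpace ℝ H] {T : ℝ} (hT : 0 ≤ T) {y v : ℝ → H}
    (hv : WeaklyContinuous T v)
    (h : ∀ t ∈ Icc 0 T, ∀ a, ⟪a, y t⟫ = ∫ τ in (0 : ℝ)..t, ⟪a, v τ⟫) :
    Continuous (clamp T y) := by
  obtain ⟨M, hM⟩ := hv.exists_norm_le
  have hM0 : 0 ≤ M := (norm_nonneg _).trans (hM 0 ⟨le_rfl, hT⟩)
  have hint : ∀ a, ∀ t ∈ Icc 0 T, ∀ r ∈ Icc 0 T,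
      IntervalIntegrable (fun τ => ⟪a, v τ⟫) volume t r := by
    intro a t ht r hr
    apply ContinuousOn.intervalIntegrable
    exact (hv (innerSL ℝ a)).mono (uIcc_subset_Icc ht hr)
  have hon : LipschitzOnWith M.toNNReal y (Icc 0 T) := by
    refine LipschitzOnWith.of_dist_le_mul fun t ht r hr => ?_
    rw [Real.coe_toNNReal _ hM0, dist_eq_norm]
    have h0 : (0 : ℝ) ∈ Icc 0 T := ⟨le_rfl, hT⟩
    -- Testing the increment against itself gives `‖a‖² = ∫ ⟪a, v⟫ ≤ ‖a‖ M |t - r|`, so `y` is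
    -- Lipschitz.
    set a := y t - y r
    have h1 : ‖a‖ * ‖a‖ ≤ (M * dist t r) * ‖a‖ := by
      have e1 : ‖a‖ * ‖a‖ = ∫ τ in r..t, ⟪a, v τ⟫ := by
        rw [← real_inner_self_eq_norm_mul_norm]
        conv_lhs => rw [show ⟪a, a⟫ = ⟪a, y t⟫ - ⟪a, y r⟫ by rw [← inner_sub_right]]
        rw [h t ht, h r hr]
        exact intervalIntegral.integral_interval_sub_left (hint a 0 h0 t ht) (hint a 0 h0 r hr)
      rw [e1]
      refine (le_abs_self _).trans ?_
      have := intervalIntegral.norm_integral_le_of_norm_le_const (a := r) (b := t)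
        (f := fun τ => ⟪a, v τ⟫) (C := ‖a‖ * M) (fun τ hτ => by
          refine (norm_inner_le_norm _ _).trans ?_
          gcongr
          exact hM τ (uIcc_subset_Icc hr ht (uIoc_subset_uIcc hτ)))
      rw [Real.norm_eq_abs] at this
      refine this.trans (le_of_eq ?_)
      rw [Real.dist_eq]
      ring
    rcases (norm_nonneg a).eq_or_lt with h2 | h2
    · rw [← h2]; positivity
    · exact le_of_mul_le_mul_right h1 h2
  exact hon.continuousOn.comp_continuous (f := fun t : ℝ => max 0 (min t T)) (by fun_prop)
    (clamp_mem hT)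

/-! ### The energy argument. -/

section Energy

variable {V H X : Type*} [NormedAddCommGroup V] [InnerProductSpace ℝ V] [CompleteSpace V]
  [SecondCountableTopology V]
  [NormedAddCommGroup H] [InnerProductSpace ℝ H] [CompleteSpace H]
  [NormedAddCommGroup X] [InnerProductSpace ℝ X] [CompleteSpace X] [SecondCountableTopology X]

/-- The energy argument: a weakly continuous function satisfying the time-integrated homogeneous
equation, tested with its own values, vanishes. -/
theorem eq_zero_of_integrated_equation {T δ : ℝ} (hT : 0 < T) (hδ : 0 < δ)
    (ι : V →L[ℝ] H) (e : V →L[ℝ] X)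
    {A : X →L[ℝ] X} (hAs : ∀ a b, ⟪A a, b⟫ = ⟪A b, a⟫) (hA0 : ∀ a, 0 ≤ ⟪A a, a⟫)
    {G : ℝ → X →L[ℝ] X}
    (hG : ContDiffOn ℝ 2 G (Ioo 0 (T + δ))) (hGi : IntervalIntegrable G volume 0 T)
    (hGs : ∀ s ∈ Ioo 0 (T + δ), ∀ a b, ⟪G s a, b⟫ = ⟪G s b, a⟫)
    (hG0 : ∀ s ∈ Ioo 0 (T + δ), ∀ a, 0 ≤ ⟪G s a, a⟫)
    (hG₁0 : ∀ s ∈ Ioo 0 (T + δ), ∀ a, ⟪deriv G s a, a⟫ ≤ 0)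
    (hG₂0 : ∀ s ∈ Ioo 0 (T + δ), ∀ a, 0 ≤ ⟪deriv (deriv G) s a, a⟫)
    {w : ℝ → V} (hw : WeakCont w) {M : ℝ} (hM : ∀ t, ‖w t‖ ≤ M) (hw0 : ∀ t ≤ 0, w t = 0)
    (hιw : Continuous fun t => ι (w t))
    {v : ℝ → H} (hv : WeaklyContinuous T v)
    (hvw : ∀ t ∈ Icc 0 T, ∀ a, ⟪a, ι (w t)⟫ = ∫ τ in (0 : ℝ)..t, ⟪a, v τ⟫)
    (heq : ∀ t ∈ Icc 0 T, ∀ r ∈ Icc 0 T, ⟪v t, ι (w r)⟫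
      + ⟪conv T G (fun t => e (w t)) t, e (w r)⟫
      + ∫ τ in (0 : ℝ)..t, ⟪A (e (w τ)), e (w r)⟫ = 0) :
    ∀ t ∈ Icc 0 T, ι (w t) = 0 := by
  have hwm : StronglyMeasurable w := hw.stronglyMeasurable
  set p : ℝ → X := fun t => e (w t) with hp
  have hpw : WeakCont p := hw.comp_clm e
  have hpm : StronglyMeasurable p := e.continuous.comp_stronglyMeasurable hwm
  have hpM : ∀ t, ‖p t‖ ≤ ‖e‖ * M := fun t => (e.le_opNorm _).trans (by gcongr; exact hM t)
  have hp0 : ∀ t ≤ 0, p t = 0 := fun t ht => by simp [hp, hw0 t ht]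
  have hpi := intervalIntegrable_of_bounded hpm hpM
  set Q : ℝ → X := fun t => ∫ s in (0 : ℝ)..t, p s with hQ
  have hQc : Continuous Q := continuous_primitive_of_bounded hpm hpM
  have hQ0 : ∀ t ≤ 0, Q t = 0 := by
    intro t ht
    simp only [hQ]
    rw [intervalIntegral.integral_congr (g := fun _ => (0 : X))]
    · simp
    · intro r hr
      rw [uIcc_of_ge ht] at hr
      exact hp0 r hr.2
  set Z : ℝ → X := fun t => ∫ s in (0 : ℝ)..t, Q s with hZ
  have hZd : ∀ t, HasDerivAt Z (Q t) t := hasDerivAt_integral_of_continuous hQc 0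
  have hZc : Continuous Z := continuous_iff_continuousAt.2 fun t => (hZd t).continuousAt
  set Y : ℝ → H := fun t => ∫ s in (0 : ℝ)..t, ι (w s) with hY
  have hYd : ∀ t, HasDerivAt Y (ι (w t)) t := hasDerivAt_integral_of_continuous hιw 0
  have hYc : Continuous Y := continuous_iff_continuousAt.2 fun t => (hYd t).continuousAt
  have hcw : WeakCont (conv T G p) := WeakCont.conv hGi hpm hpw hpM
  have hci := intervalIntegrable_of_bounded hcw.stronglyMeasurable
    (norm_conv_le hT.le hGi hpM)
  -- the equation integrated once more
  have eq2 : ∀ t ∈ Icc 0 T, ∀ r ∈ Icc 0 T, ⟪ι (w t), ι (w r)⟫ + ⟪conv T G Q t, e (w r)⟫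
      + ⟪A (Z t), e (w r)⟫ = 0 := by
    intro t ht r hr
    have hAi : ∀ a b, IntervalIntegrable (fun τ => A (p τ)) volume a b := fun a b =>
      intervalIntegrable_of_bounded (A.continuous.comp_stronglyMeasurable hpm)
        (M := ‖A‖ * (‖e‖ * M)) (fun t => (A.le_opNorm _).trans (by gcongr; exact hpM t)) a b
    have h1 : ∫ τ in (0 : ℝ)..t, ⟪v τ, ι (w r)⟫ = ⟪ι (w t), ι (w r)⟫ := by
      have := hvw t ht (ι (w r))
      simpa only [real_inner_comm] using this.symm
    have h2 : ∫ τ in (0 : ℝ)..t, ⟪conv T G p τ, e (w r)⟫ = ⟪conv T G Q t, e (w r)⟫ := by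
      rw [integral_inner_left (hci 0 t), conv_integral hT.le hGi hpm hpM hp0]
    have h3 : ∀ τ, ∫ ρ in (0 : ℝ)..τ, ⟪A (p ρ), e (w r)⟫ = ⟪A (Q τ), e (w r)⟫ := fun τ => by
      rw [integral_inner_left (hAi 0 τ), A.intervalIntegral_comp_comm (hpi 0 τ)]
    have h4 : ∫ τ in (0 : ℝ)..t, ⟪A (Q τ), e (w r)⟫ = ⟪A (Z t), e (w r)⟫ := by
      rw [integral_inner_left (p := fun τ => A (Q τ))
          ((A.continuous.comp hQc).intervalIntegrable 0 t),
        A.intervalIntegral_comp_comm (hQc.intervalIntegrable 0 t)]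
    rw [← h1, ← h2, ← h4]
    simp only [← h3]
    have i1 : IntervalIntegrable (fun τ => ⟪v τ, ι (w r)⟫) volume 0 t := by
      apply ContinuousOn.intervalIntegrable
      have := (hv (innerSL ℝ (ι (w r)))).mono (uIcc_subset_Icc ⟨le_rfl, hT.le⟩ ht)
      simpa only [innerSL_apply_apply, real_inner_comm] using this
    have i2 : IntervalIntegrable (fun τ => ⟪conv T G p τ, e (w r)⟫) volume 0 t := by
      have := (hcw (innerSL ℝ (e (w r)))).intervalIntegrable (μ := volume) 0 t
      simpa only [innerSL_apply_apply, real_inner_comm] using this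
    have i3 : IntervalIntegrable (fun τ => ∫ ρ in (0 : ℝ)..τ, ⟪A (p ρ), e (w r)⟫) volume 0 t := by
      simp only [h3]
      apply Continuous.intervalIntegrable
      fun_prop
    rw [← intervalIntegral.integral_add i1 i2, ← intervalIntegral.integral_add (i1.add i2) i3]
    rw [intervalIntegral.integral_congr (g := fun _ => (0 : ℝ))]
    · simp
    · intro τ hτ
      exact heq τ (uIcc_subset_Icc ⟨le_rfl, hT.le⟩ ht hτ) r hr
  -- test with the primitive of `w`
  have eq3 : ∀ t ∈ Icc 0 T, ⟪ι (w t), Y t⟫ + ⟪conv T G Q t, Q t⟫ + ⟪A (Z t), Q t⟫ = 0 := by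
    intro t ht
    -- At frozen `t` the equation says that one continuous functional kills every `w r`, hence also
    -- their integral. The primitive of `w` thus never has to be shown admissible itself.
    set L : V →L[ℝ] ℝ := (innerSL ℝ (ι (w t))).comp ι + (innerSL ℝ (conv T G Q t)).comp e
      + (innerSL ℝ (A (Z t))).comp e with hL
    have hwi := intervalIntegrable_of_bounded hwm hM 0 t
    have h1 : L (∫ r in (0 : ℝ)..t, w r) = 0 := by
      rw [← L.intervalIntegral_comp_comm hwi,
        intervalIntegral.integral_congr (g := fun _ => (0 : ℝ))]
      · simp
      · intro r hr
        have := eq2 t ht r (uIcc_subset_Icc ⟨le_rfl, hT.le⟩ ht hr)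
        simpa [hL] using this
    have h2 : ι (∫ r in (0 : ℝ)..t, w r) = Y t := (ι.intervalIntegral_comp_comm hwi).symm
    have h3 : e (∫ r in (0 : ℝ)..t, w r) = Q t := (e.intervalIntegral_comp_comm hwi).symm
    simpa [hL, h2, h3] using h1
  -- The positivity lemma asks for a globally bounded function. Freezing `Q` after `T` provides one,
  -- and the convolution at `t ≤ T` sees only times up to `t`.
  have hclQ : Continuous (clamp T Q) :=
    hQc.comp (show Continuous fun t : ℝ => max 0 (min t T) by fun_prop)
  obtain ⟨K, hK⟩ : ∃ K, ∀ t, ‖clamp T Q t‖ ≤ K := by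
    obtain ⟨K, hK⟩ := isCompact_Icc.exists_bound_of_continuousOn (hQc.continuousOn (s := Icc 0 T))
    exact ⟨K, fun t => hK _ (clamp_mem hT.le t)⟩
  have hclm : StronglyMeasurable (clamp T Q) := hclQ.stronglyMeasurable
  have hconv : ∀ t ∈ Icc 0 T, conv T G (clamp T Q) t = conv T G Q t := by
    intro t ht
    refine conv_congr hT.le fun r hr => ?_
    rcases le_total r 0 with h | h
    · rw [clamp_of_nonpos hT.le Q h, hQ0 r h, hQ0 0 le_rfl]
    · exact clamp_of_mem Q ⟨h, hr.trans ht.2⟩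
  have hYz : ∀ σ ∈ Icc 0 T, Y σ = 0 := by
    intro σ hσ
    have hpos := integral_conv_nonneg hT hδ hG hGi hGs hG0 hG₁0 hG₂0 hclQ hclm hK
      (fun t ht => by rw [clamp_of_nonpos hT.le Q ht, hQ0 0 le_rfl]) hσ
    have c1 : Continuous fun t => ⟪ι (w t), Y t⟫ := hιw.inner hYc
    have c2 : Continuous fun t => ⟪conv T G (clamp T Q) t, clamp T Q t⟫ :=
      (continuous_conv hGi hclQ hK hclm).inner hclQ
    have c3 : Continuous fun t => ⟪A (Z t), Q t⟫ := by fun_prop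
    have h1 : ∫ t in (0 : ℝ)..σ, ⟪ι (w t), Y t⟫ = ‖Y σ‖ ^ 2 / 2 := by
      rw [intervalIntegral.integral_eq_sub_of_hasDerivAt (f := fun t => ‖Y t‖ ^ 2 / 2)
        (fun t _ => ?_) (c1.intervalIntegrable _ _)]
      · simp [hY]
      · have := (hYd t).norm_sq.div_const 2
        rw [real_inner_comm]
        simpa using this
    have h2 : ∫ t in (0 : ℝ)..σ, ⟪A (Z t), Q t⟫ = ⟪A (Z σ), Z σ⟫ / 2 := by
      rw [intervalIntegral.integral_eq_sub_of_hasDerivAt (f := fun t => ⟪A (Z t), Z t⟫ / 2)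
        (fun t _ => ?_) (c3.intervalIntegrable _ _)]
      · simp [hZ]
      · have := (HasDerivAt.inner_clm_self (hasDerivAt_const t A) (hZd t) hAs).div_const 2
        simpa using this
    have h3 : (∫ t in (0 : ℝ)..σ, ⟪ι (w t), Y t⟫)
        + (∫ t in (0 : ℝ)..σ, ⟪conv T G (clamp T Q) t, clamp T Q t⟫)
        + ∫ t in (0 : ℝ)..σ, ⟪A (Z t), Q t⟫ = 0 := by
      have i1 := c1.intervalIntegrable (μ := volume) 0 σ
      have i2 := c2.intervalIntegrable (μ := volume) 0 σ
      rw [← intervalIntegral.integral_add i1 i2, ← intervalIntegral.integral_add (i1.add i2)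
        (c3.intervalIntegrable _ _), intervalIntegral.integral_congr (g := fun _ => (0 : ℝ))]
      · simp
      · intro t ht
        have ht' : t ∈ Icc 0 T := uIcc_subset_Icc ⟨le_rfl, hT.le⟩ hσ ht
        simp only [hconv t ht', clamp_of_mem Q ht']
        exact eq3 t ht'
    have h4 := hA0 (Z σ)
    -- Three non-negative terms add up to zero.
    have h5 : ‖Y σ‖ ^ 2 ≤ 0 := by linarith
    have h6 : ‖Y σ‖ ^ 2 = 0 := le_antisymm h5 (by positivity)
    simpa using h6
  intro t ht
  have hu := uniqueDiffOn_Icc hT t ht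
  have h1 : HasDerivWithinAt Y 0 (Icc 0 T) t :=
    (hasDerivWithinAt_const t (Icc 0 T) (0 : H)).congr (fun s hs => hYz s hs) (hYz t ht)
  exact hu.eq_deriv _ (hYd t).hasDerivWithinAt h1

end Energy

/-! ### Realisation in `L²(Ω)` and `H¹(Ω ∖ K)`. -/

section Concrete

variable {d : ℕ} {Ω : Set (Vec d)}

theorem secondCountableTopology_Lp {E : Type*} [NormedAddCommGroup E]
    [SecondCountableTopology E] : SecondCountableTopology (Lp E 2 (volume.restrict Ω)) :=
  have : Fact ((2 : ℝ≥0∞) ≠ ⊤) := ⟨by simp⟩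
  Lp.SecondCountableTopology

theorem secondCountableTopology_L2Pair : SecondCountableTopology (L2Pair d Ω) := by
  have : SecondCountableTopology (L2Vec d Ω) := secondCountableTopology_Lp
  have : SecondCountableTopology (L2Mat d Ω) := secondCountableTopology_Lp
  exact (WithLp.prodContinuousLinearEquiv 2 ℝ (L2Vec d Ω)
    (L2Mat d Ω)).toHomeomorph.secondCountableTopology

/-! ### Tensor fields as multiplication operators -/

/-- The multiplication operator on `L²(Ω; ℝ^{d×d}_sym)` given by a tensor field. -/
noncomputable def tensorOp (d : ℕ) (Ω : Set (Vec d)) :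
    TensorField d Ω →L[ℝ] L2Sym d Ω →L[ℝ] L2Sym d Ω :=
  (ContinuousLinearMap.id ℝ (symMat d →L[ℝ] symMat d)).holderL (volume.restrict Ω) ∞ 2 2

theorem coeFn_tensorOp (A : TensorField d Ω) (ξ : L2Sym d Ω) :
    tensorOp d Ω A ξ =ᵐ[volume.restrict Ω] fun x => A x (ξ x) := by
  have h := ContinuousLinearMap.coeFn_holder (𝕜 := ℝ) (E := symMat d →L[ℝ] symMat d)
    (F := symMat d) (G := symMat d) (μ := volume.restrict Ω) (p := ⊤) (q := 2) (r := 2)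
    (ContinuousLinearMap.id ℝ (symMat d →L[ℝ] symMat d)) A ξ
  simp only [ContinuousLinearMap.id_apply] at h
  exact h

theorem inner_tensorOp (A : TensorField d Ω) (ξ η : L2Sym d Ω) :
    ⟪tensorOp d Ω A ξ, η⟫ = tensorForm A ξ η := by
  rw [L2.inner_def, tensorForm]
  refine integral_congr_ae ?_
  filter_upwards [coeFn_tensorOp A ξ] with x hx
  rw [hx]

/-- The exceptional null set in `TensorSymm` depends on the two matrices. A countable dense set of
matrices gives a common null set, and continuity extends the identity to the values of the fields.
-/
theorem TensorSymm.inner_tensorOp {A : TensorField d Ω} (hA : TensorSymm A) (ξ η : L2Sym d Ω) :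
    ⟪tensorOp d Ω A ξ, η⟫ = ⟪tensorOp d Ω A η, ξ⟫ := by
  rw [FracKV.inner_tensorOp, FracKV.inner_tensorOp, tensorForm, tensorForm]
  refine integral_congr_ae ?_
  have h1 : ∀ᵐ x ∂(volume.restrict Ω), ∀ m n : ℕ,
      ⟪A x (TopologicalSpace.denseSeq (symMat d) m), TopologicalSpace.denseSeq (symMat d) n⟫
        = ⟪A x (TopologicalSpace.denseSeq (symMat d) n),
            TopologicalSpace.denseSeq (symMat d) m⟫ :=
    ae_all_iff.2 fun m => ae_all_iff.2 fun n => hA _ _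
  filter_upwards [h1] with x hx
  have hd := TopologicalSpace.denseRange_denseSeq (symMat d)
  refine hd.induction_on₂ (p := fun a b => ⟪A x a, b⟫ = ⟪A x b, a⟫) ?_ hx (ξ x) (η x)
  exact isClosed_eq (by fun_prop) (by fun_prop)

theorem TensorNonneg.inner_tensorOp {A : TensorField d Ω} (hA : TensorNonneg A) (ξ : L2Sym d Ω) :
    0 ≤ ⟪tensorOp d Ω A ξ, ξ⟫ := by
  rw [FracKV.inner_tensorOp, tensorForm]
  refine integral_nonneg_of_ae ?_
  have h1 : ∀ᵐ x ∂(volume.restrict Ω), ∀ m : ℕ,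
      0 ≤ ⟪A x (TopologicalSpace.denseSeq (symMat d) m), TopologicalSpace.denseSeq (symMat d) m⟫ :=
    ae_all_iff.2 fun m => hA _
  filter_upwards [h1] with x hx
  have hd := TopologicalSpace.denseRange_denseSeq (symMat d)
  refine hd.induction_on (p := fun a => 0 ≤ ⟪A x a, a⟫) (ξ x) ?_ hx
  exact isClosed_le continuous_const (by fun_prop)

theorem TensorNonpos.inner_tensorOp {A : TensorField d Ω} (hA : TensorNonpos A) (ξ : L2Sym d Ω) :
    ⟪tensorOp d Ω A ξ, ξ⟫ ≤ 0 := by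
  have h : TensorNonneg (-A) := by
    intro η
    filter_upwards [hA η, Lp.coeFn_neg A] with x hx hx'
    rw [hx']
    simpa using hx
  have h1 := h.inner_tensorOp ξ
  rw [map_neg] at h1
  exact neg_nonneg.1 (h1.trans_eq (inner_neg_left (𝕜 := ℝ) (tensorOp d Ω A ξ) ξ))

theorem TensorCoercive.nonneg {A : TensorField d Ω} (hA : TensorCoercive A) : TensorNonneg A := by
  obtain ⟨γ, hγ, h⟩ := hA
  intro ξ
  filter_upwards [h ξ] with x hx
  exact le_trans (by positivity) hx

/-! ### Sobolev functions -/

/-- The function component of a pair. -/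
noncomputable def fnL (d : ℕ) (Ω : Set (Vec d)) : L2Pair d Ω →L[ℝ] L2Vec d Ω :=
  WithLp.fstL 2 ℝ (L2Vec d Ω) (L2Mat d Ω)

/-- The symmetric part of the matrix component of a pair. -/
noncomputable def strainL (d : ℕ) (Ω : Set (Vec d)) : L2Pair d Ω →L[ℝ] L2Sym d Ω :=
  ((symPart d).compLpL 2 (volume.restrict Ω)).comp (WithLp.sndL 2 ℝ (L2Vec d Ω) (L2Mat d Ω))

theorem strain_eq {K : Set (Vec d)} (w : H1 Ω K) : strain w = strainL d Ω w := rfl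

/-- A Sobolev function that vanishes almost everywhere has vanishing gradient. -/
theorem eq_zero_of_mem_H1_of_fst_eq_zero {K : Set (Vec d)} (hΩ : IsOpen Ω) (hK : IsClosed K)
    (hK0 : volume K = 0) {w : L2Pair d Ω} (hw : w ∈ H1 Ω K) (h0 : w.fst = 0) : w = 0 := by
  have hcomp : ∀ i j : Fin d, ∀ᵐ x ∂(volume.restrict Ω), x ∈ Ω \ K → w.snd x (i, j) = 0 := by
    intro i j
    have hm : MemLp (fun x => w.snd x (i, j)) 2 (volume.restrict Ω) :=
      (EuclideanSpace.proj (𝕜 := ℝ) (i, j)).comp_memLp' (Lp.memLp w.snd)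
    -- With zero function part, the weak gradient identity says that each gradient entry is
    -- orthogonal to all test functions in `Ω \ K`.
    refine (hΩ.sdiff hK).ae_eq_zero_of_integral_contDiff_smul_eq_zero
      ((hm.locallyIntegrable (by norm_num)).locallyIntegrableOn _) fun φ h1 h2 h3 => ?_
    have h := hw φ h1 h2 h3 i j
    have e1 : ∀ᵐ x ∂(volume.restrict Ω), w.fst x i * partialDeriv φ j x = 0 := by
      filter_upwards [Lp.coeFn_zero (Vec d) 2 (volume.restrict Ω)] with x hx
      rw [h0, hx]
      simp
    rw [integral_congr_ae e1, integral_zero, eq_comm, neg_eq_zero] at h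
    simpa [mul_comm] using h
  have hsnd : w.snd = 0 := by
    refine Lp.ext ?_
    have hall := ae_all_iff.2 fun i => ae_all_iff.2 fun j => hcomp i j
    have hKae : ∀ᵐ x ∂(volume.restrict Ω), x ∉ K :=
      ae_restrict_of_ae (measure_eq_zero_iff_ae_notMem.1 hK0)
    filter_upwards [hall, hKae, ae_restrict_mem hΩ.measurableSet,
      Lp.coeFn_zero (Mat d) 2 (volume.restrict Ω)] with x h1 h2 h3 h4
    rw [h4]
    ext ⟨i, j⟩
    simpa using h1 i j ⟨h3, h2⟩
  apply WithLp.ofLp_injective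
  exact Prod.ext h0 hsnd

theorem integrableOn_norm_ball (u : L2Vec d Ω) (x : Vec d) (r : ℝ) :
    IntegrableOn (fun y => ‖u y‖) (Metric.ball x r ∩ Ω) := by
  have h1 : MemLp u 2 (volume.restrict (Metric.ball x r ∩ Ω)) :=
    (Lp.memLp u).mono_measure (Measure.restrict_mono inter_subset_right le_rfl)
  have : IsFiniteMeasure (volume.restrict (Metric.ball x r ∩ Ω)) :=
    isFiniteMeasure_restrict.2
      ((measure_mono inter_subset_left).trans_lt measure_ball_lt_top).ne
  exact (h1.integrable (by norm_num)).norm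

/-- A zero trace means that the averages of `‖u‖` tend to zero, so the triangle inequality is enough
and no trace theorem is needed. -/
theorem HasTraceAt.sub_zero {u v : L2Vec d Ω} {x : Vec d} (hu : HasTraceAt Ω u x 0)
    (hv : HasTraceAt Ω v x 0) : HasTraceAt Ω (u - v : L2Vec d Ω) x 0 := by
  unfold HasTraceAt at *
  simp only [_root_.sub_zero] at *
  have hs := hu.add hv
  rw [add_zero] at hs
  refine squeeze_zero (fun r => ?_) (fun r => ?_) hs
  · rw [setAverage_eq]
    exact smul_nonneg (by positivity) (integral_nonneg fun _ => norm_nonneg _)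
  · simp only [setAverage_eq, ← smul_add]
    refine smul_le_smul_of_nonneg_left ?_ (by positivity)
    rw [← integral_add (integrableOn_norm_ball u x r) (integrableOn_norm_ball v x r)]
    refine integral_mono_ae (integrableOn_norm_ball _ x r)
      ((integrableOn_norm_ball u x r).add (integrableOn_norm_ball v x r)) ?_
    have := ae_restrict_of_ae_restrict_of_subset (inter_subset_right (s := Metric.ball x r))
      (Lp.coeFn_sub u v)
    filter_upwards [this] with y hy
    rw [hy]
    exact norm_sub_le _ _

theorem HasTraceAt.smul_zero {u : L2Vec d Ω} {x : Vec d} (hu : HasTraceAt Ω u x 0) (c : ℝ) :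
    HasTraceAt Ω (c • u : L2Vec d Ω) x 0 := by
  unfold HasTraceAt at *
  simp only [_root_.sub_zero] at *
  have hs := hu.const_mul |c|
  rw [mul_zero] at hs
  refine hs.congr fun r => ?_
  simp only [setAverage_eq, smul_eq_mul]
  rw [mul_left_comm, ← integral_const_mul]
  congr 1
  refine integral_congr_ae ?_
  have := ae_restrict_of_ae_restrict_of_subset (inter_subset_right (s := Metric.ball x r))
    (Lp.coeFn_smul c u)
  filter_upwards [this] with y hy
  rw [hy]
  simp [norm_smul]

theorem sub_mem_H1D {D K : Set (Vec d)} {v w : L2Pair d Ω} (hv : v ∈ H1D Ω D K)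
    (hw : w ∈ H1D Ω D K) : v - w ∈ H1D Ω D K := by
  refine ⟨(H1 Ω K).sub_mem hv.1 hw.1, ?_⟩
  filter_upwards [hv.2, hw.2] with x h1 h2
  exact h1.sub_zero h2

theorem smul_mem_H1D {D K : Set (Vec d)} {w : L2Pair d Ω} (hw : w ∈ H1D Ω D K) (c : ℝ) :
    c • w ∈ H1D Ω D K := by
  refine ⟨(H1 Ω K).smul_mem c hw.1, ?_⟩
  filter_upwards [hw.2] with x h1
  exact h1.smul_zero c

end Concrete

/-- The convolution term of the weak formulation as an integral over `(0,t)`. -/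
theorem integral_inner_kernel_eq_inner_conv {X : Type*} [NormedAddCommGroup X]
    [InnerProductSpace ℝ X] [CompleteSpace X] {T : ℝ} (hT : 0 ≤ T) {G : ℝ → X →L[ℝ] X}
    (hG : IntervalIntegrable G volume 0 T) {p : ℝ → X} (hp : StronglyMeasurable (clamp T p))
    {M : ℝ} (hM : ∀ t, ‖clamp T p t‖ ≤ M) (hp0 : p 0 = 0) {t : ℝ} (ht : t ∈ Icc 0 T) (q : X) :
    ∫ r in (0 : ℝ)..t, ⟪G (t - r) (p r), q⟫ = ⟪conv T G (clamp T p) t, q⟫ := by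
  have h0 := clm_conv hG hp hM (innerSL ℝ q) t
  simp only [innerSL_apply_apply, ← real_inner_comm q] at h0
  have hi : IntervalIntegrable (fun s => ⟪G s (clamp T p (t - s)), q⟫) volume 0 T := by
    have := intervalIntegrable_conv hG hp hM t
    rw [intervalIntegrable_iff] at this ⊢
    have h1 := (innerSL ℝ q).integrable_comp this
    simp only [innerSL_apply_apply, ← real_inner_comm q] at h1
    exact h1
  have h1 : ∫ r in (0 : ℝ)..t, ⟪G (t - r) (p r), q⟫
      = ∫ s in (0 : ℝ)..t, ⟪G s (clamp T p (t - s)), q⟫ := by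
    have := intervalIntegral.integral_comp_sub_left (a := 0) (b := t)
      (fun s => ⟪G s (clamp T p (t - s)), q⟫) t
    rw [sub_self, sub_zero] at this
    rw [← this]
    refine intervalIntegral.integral_congr fun r hr => ?_
    rw [uIcc_of_le ht.1] at hr
    simp only [sub_sub_cancel, clamp_of_mem p ⟨hr.1, hr.2.trans ht.2⟩]
  -- Lags beyond `t` reach negative times, where the extension has the value `p 0 = 0`. The upper
  -- limit can thus be `T` for every `t`.
  have h2 : ∫ s in t..T, ⟪G s (clamp T p (t - s)), q⟫ = 0 := by
    rw [intervalIntegral.integral_congr (g := fun _ => (0 : ℝ))]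
    · simp
    · intro s hs
      rw [uIcc_of_le ht.2] at hs
      simp [clamp_of_nonpos hT p (show t - s ≤ 0 by linarith [hs.1]), hp0]
  have h3 := intervalIntegral.integral_add_adjacent_intervals
    (hi.mono_set (c := 0) (d := t) (uIcc_subset_uIcc left_mem_uIcc (by rwa [uIcc_of_le hT])))
    (hi.mono_set (c := t) (d := T) (uIcc_subset_uIcc (by rwa [uIcc_of_le hT]) right_mem_uIcc))
  rw [h1, h0, ← h3, h2, add_zero]

/-- Pairing with a fixed `a` leaves a scalar distributional derivative, to which the du Bois-Reymond
lemma applies. -/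
theorem IsTimeDeriv.inner_eq_add_integral {H : Type*} [NormedAddCommGroup H]
    [InnerProductSpace ℝ H] {T : ℝ} (hT : 0 < T) {y v : ℝ → H} (hy : WeaklyContinuous T y)
    (hv : WeaklyContinuous T v) (h : IsTimeDeriv T y v) :
    ∀ t ∈ Icc 0 T, ∀ a, ⟪a, y t⟫ = ⟪a, y 0⟫ + ∫ τ in (0 : ℝ)..t, ⟪a, v τ⟫ := by
  intro t ht a
  have := eq_sub_integral_of_integral_deriv_mul hT (p := fun t => ⟪a, y t⟫)
    (q := fun t => -⟪a, v t⟫) (hy (innerSL ℝ a)) (hv (innerSL ℝ a)).neg (by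
      intro η h1 h2 h3
      have := h η h1 h2 h3 (innerSL ℝ a)
      simp only [intervalIntegral.integral_of_le hT.le, integral_Ioc_eq_integral_Ioo, mul_neg,
        integral_neg]
      simpa only [innerSL_apply_apply] using this) t ht
  simp only [intervalIntegral.integral_neg, sub_neg_eq_add] at this
  exact this

theorem conv_sub {X : Type*} [NormedAddCommGroup X] [NormedSpace ℝ X] {T : ℝ}
    {G : ℝ → X →L[ℝ] X} (hG : IntervalIntegrable G volume 0 T) {p q : ℝ → X} {M K : ℝ}
    (hp : StronglyMeasurable p) (hM : ∀ t, ‖p t‖ ≤ M) (hq : StronglyMeasurable q)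
    (hK : ∀ t, ‖q t‖ ≤ K) (t : ℝ) :
    conv T G (fun t => p t - q t) t = conv T G p t - conv T G q t := by
  simp only [conv, map_sub]
  exact intervalIntegral.integral_sub (intervalIntegrable_conv hG hp hM t)
    (intervalIntegrable_conv hG hq hK t)

/-! ### From the weak formulation to the integrated equation, in abstract spaces. -/

section Abstract

variable {V H X B : Type*} [NormedAddCommGroup V] [InnerProductSpace ℝ V] [CompleteSpace V]
  [SecondCountableTopology V]
  [NormedAddCommGroup H] [InnerProductSpace ℝ H] [CompleteSpace H]
  [NormedAddCommGroup X] [InnerProductSpace ℝ X] [CompleteSpace X] [SecondCountableTopology X]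
  [NormedAddCommGroup B] [NormedSpace ℝ B]

theorem WeaklyContinuous.inner_right {E : Type*} [NormedAddCommGroup E] [InnerProductSpace ℝ E]
    {T : ℝ} {p : ℝ → E} (hp : WeaklyContinuous T p) (a : E) :
    ContinuousOn (fun t => ⟪p t, a⟫) (Icc 0 T) := by
  simp only [real_inner_comm a]
  exact hp (innerSL ℝ a)

theorem WeakCont.inner_right {E : Type*} [NormedAddCommGroup E] [InnerProductSpace ℝ E]
    {p : ℝ → E} (hp : WeakCont p) (a : E) : Continuous fun t => ⟪p t, a⟫ := by
  simp only [real_inner_comm a]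
  exact hp (innerSL ℝ a)

omit [CompleteSpace H] in
/-- The weak formulation tested with a product `η(t) ψ`, with the convolution term rewritten. -/
theorem integral_deriv_mul_eq_of_weak_formulation {T : ℝ} (hT : 0 < T) {G : ℝ → X →L[ℝ] X}
    (hG : IntervalIntegrable G volume 0 T) {A : X →L[ℝ] X} {v : ℝ → H} {y p : ℝ → X}
    (hv : WeaklyContinuous T v) (hp : WeaklyContinuous T p) (hp0 : p 0 = 0)
    {η : ℝ → ℝ} (hη : ContDiff ℝ ∞ η) {a : H} {b : X} {R : ℝ}
    (h : - (∫ t in (0 : ℝ)..T, ⟪v t, deriv η t • a⟫) + (∫ t in (0 : ℝ)..T, ⟪A (y t), η t • b⟫)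
        - (∫ t in (0 : ℝ)..T, ∫ r in (0 : ℝ)..t, ⟪G (t - r) (p r), deriv η t • b⟫) = R) :
    ∫ t in (0 : ℝ)..T, deriv η t * (⟪v t, a⟫ + ⟪conv T G (clamp T p) t, b⟫)
      = (∫ t in (0 : ℝ)..T, η t * ⟪A (y t), b⟫) - R := by
  have hdη : Continuous (deriv η) := hη.continuous_deriv (by simp)
  obtain ⟨M, hM⟩ := hp.exists_norm_clamp_le hT.le
  have hpc := hp.clamp hT.le
  have hpm := hpc.stronglyMeasurable
  have e3 : ∫ t in (0 : ℝ)..T, ∫ r in (0 : ℝ)..t, ⟪G (t - r) (p r), deriv η t • b⟫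
      = ∫ t in (0 : ℝ)..T, deriv η t * ⟪conv T G (clamp T p) t, b⟫ := by
    refine intervalIntegral.integral_congr fun t ht => ?_
    rw [uIcc_of_le hT.le] at ht
    simp only [real_inner_smul_right, intervalIntegral.integral_const_mul]
    rw [integral_inner_kernel_eq_inner_conv hT.le hG hpm hM hp0 ht b]
  have i1 : IntervalIntegrable (fun t => deriv η t * ⟪v t, a⟫) volume 0 T := by
    apply ContinuousOn.intervalIntegrable
    rw [uIcc_of_le hT.le]
    exact hdη.continuousOn.mul (hv.inner_right a)
  have i2 : IntervalIntegrable (fun t => deriv η t * ⟪conv T G (clamp T p) t, b⟫) volume 0 T :=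
    (hdη.mul ((WeakCont.conv hG hpm hpc hM).inner_right b)).intervalIntegrable _ _
  rw [e3] at h
  simp only [real_inner_smul_right] at h
  simp only [mul_add]
  rw [intervalIntegral.integral_add i1 i2]
  linarith

/-- Uniqueness for the abstract evolution equation
`d/dt (u' + e* ∫₀ᵗ Λ(F(t - r)) (e u(r) - e u⁰) dr) + e* Λ(C) e u = g`, in the weak form with test
functions `η(t) ψ`, where `ψ` ranges over a set `S` containing the differences of the solutions. -/
theorem eq_of_abstract_weak_formulation {T δ : ℝ} (hT : 0 < T) (hδ : 0 < δ)
    (ι : V →L[ℝ] H) (e : V →L[ℝ] X) (Λ : B →L[ℝ] X →L[ℝ] X) {C : B} {F : ℝ → B}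
    (hCs : ∀ a b, ⟪Λ C a, b⟫ = ⟪Λ C b, a⟫) (hC0 : ∀ a, 0 ≤ ⟪Λ C a, a⟫)
    (hF : ContDiffOn ℝ 2 F (Ioo 0 (T + δ))) (hFi : IntegrableOn F (Ioo 0 (T + δ)))
    (hFs : ∀ s ∈ Ioo 0 (T + δ), ∀ a b, ⟪Λ (F s) a, b⟫ = ⟪Λ (F s) b, a⟫)
    (hF0 : ∀ s ∈ Ioo 0 (T + δ), ∀ a, 0 ≤ ⟪Λ (F s) a, a⟫)
    (hF₁0 : ∀ s ∈ Ioo 0 (T + δ), ∀ a, ⟪Λ (deriv F s) a, a⟫ ≤ 0)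
    (hF₂0 : ∀ s ∈ Ioo 0 (T + δ), ∀ a, 0 ≤ ⟪Λ (deriv (deriv F) s) a, a⟫)
    {S : Set V} {R : (ℝ → ℝ) → V → ℝ} {u0 : V} {u1 : H} {u₁ u₂ : ℝ → V} {v₁ v₂ : ℝ → H}
    (hu₁ : WeaklyContinuous T u₁) (hu₂ : WeaklyContinuous T u₂)
    (hi₁ : u₁ 0 = u0) (hi₂ : u₂ 0 = u0) (hS : ∀ t ∈ Icc 0 T, u₁ t - u₂ t ∈ S)
    (hv₁ : WeaklyContinuous T v₁) (hv₂ : WeaklyContinuous T v₂)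
    (hd₁ : IsTimeDeriv T (fun t => ι (u₁ t)) v₁) (hd₂ : IsTimeDeriv T (fun t => ι (u₂ t)) v₂)
    (hv0₁ : v₁ 0 = u1) (hv0₂ : v₂ 0 = u1)
    (he₁ : ∀ η : ℝ → ℝ, ContDiff ℝ ∞ η → HasCompactSupport η → tsupport η ⊆ Ioo 0 T →
      ∀ ψ ∈ S, - (∫ t in (0 : ℝ)..T, ⟪v₁ t, deriv η t • ι ψ⟫)
        + (∫ t in (0 : ℝ)..T, ⟪Λ C (e (u₁ t)), η t • e ψ⟫)
        - (∫ t in (0 : ℝ)..T, ∫ r in (0 : ℝ)..t,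
            ⟪Λ (F (t - r)) (e (u₁ r) - e u0), deriv η t • e ψ⟫) = R η ψ)
    (he₂ : ∀ η : ℝ → ℝ, ContDiff ℝ ∞ η → HasCompactSupport η → tsupport η ⊆ Ioo 0 T →
      ∀ ψ ∈ S, - (∫ t in (0 : ℝ)..T, ⟪v₂ t, deriv η t • ι ψ⟫)
        + (∫ t in (0 : ℝ)..T, ⟪Λ C (e (u₂ t)), η t • e ψ⟫)
        - (∫ t in (0 : ℝ)..T, ∫ r in (0 : ℝ)..t,
            ⟪Λ (F (t - r)) (e (u₂ r) - e u0), deriv η t • e ψ⟫) = R η ψ) :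
    ∀ t ∈ Icc 0 T, ι (u₁ t - u₂ t) = 0 := by
  have h0T : (0 : ℝ) ∈ Icc 0 T := ⟨le_rfl, hT.le⟩
  set G : ℝ → X →L[ℝ] X := fun t => Λ (F t) with hGdef
  have hGc : ContDiffOn ℝ 2 G (Ioo 0 (T + δ)) := Λ.contDiff.comp_contDiffOn hF
  have hGi : IntervalIntegrable G volume 0 T := by
    rw [intervalIntegrable_iff, uIoc_of_le hT.le]
    have h1 : IntegrableOn F (Ioc 0 T) := hFi.mono_set fun s hs => ⟨hs.1, by linarith [hs.2]⟩
    exact Λ.integrable_comp h1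
  -- `Λ` is linear and continuous, so it commutes with differentiation and the sign conditions pass
  -- from `F` to `G`.
  have hdG : ∀ s ∈ Ioo 0 (T + δ), deriv G s = Λ (deriv F s) := fun s hs =>
    (Λ.hasFDerivAt.comp_hasDerivAt s ((hF.differentiableOn (by simp)).differentiableAt
      (isOpen_Ioo.mem_nhds hs)).hasDerivAt).deriv
  have hdF : ContDiffOn ℝ 1 (deriv F) (Ioo 0 (T + δ)) :=
    ((contDiffOn_succ_iff_deriv_of_isOpen (n := 1) isOpen_Ioo).1 hF).2.2
  have hddG : ∀ s ∈ Ioo 0 (T + δ), deriv (deriv G) s = Λ (deriv (deriv F) s) := by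
    intro s hs
    have h1 : deriv G =ᶠ[𝓝 s] fun s => Λ (deriv F s) := by
      filter_upwards [isOpen_Ioo.mem_nhds hs] with r hr using hdG r hr
    rw [h1.deriv_eq]
    exact (Λ.hasFDerivAt.comp_hasDerivAt s ((hdF.differentiableOn (by simp)).differentiableAt
      (isOpen_Ioo.mem_nhds hs)).hasDerivAt).deriv
  set w : ℝ → V := fun t => u₁ t - u₂ t with hw
  have hww : WeaklyContinuous T w := hu₁.sub hu₂
  have hw0 : w 0 = 0 := by simp [hw, hi₁, hi₂]
  set v : ℝ → H := fun t => v₁ t - v₂ t with hv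
  have hvw : WeaklyContinuous T v := hv₁.sub hv₂
  have hderiv : ∀ t ∈ Icc 0 T, ∀ a, ⟪a, ι (w t)⟫ = ∫ τ in (0 : ℝ)..t, ⟪a, v τ⟫ := by
    intro t ht a
    have hint : ∀ {v : ℝ → H}, WeaklyContinuous T v →
        IntervalIntegrable (fun τ => ⟪a, v τ⟫) volume 0 t := fun hv =>
      ContinuousOn.intervalIntegrable ((hv (innerSL ℝ a)).mono (uIcc_subset_Icc h0T ht))
    have h1 := hd₁.inner_eq_add_integral hT (hu₁.comp_clm ι) hv₁ t ht a
    have h2 := hd₂.inner_eq_add_integral hT (hu₂.comp_clm ι) hv₂ t ht a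
    simp only [hv, inner_sub_right]
    rw [intervalIntegral.integral_sub (hint hv₁) (hint hv₂)]
    simp only [hi₁, hi₂] at h1 h2
    simp only [hw, map_sub, inner_sub_right, h1, h2]
    ring
  obtain ⟨M, hM⟩ := hww.exists_norm_clamp_le hT.le
  have hcw : WeakCont (clamp T w) := hww.clamp hT.le
  set p₁ : ℝ → X := fun t => e (u₁ t) - e u0 with hp₁
  set p₂ : ℝ → X := fun t => e (u₂ t) - e u0 with hp₂
  have hconst : WeaklyContinuous T fun _ => e u0 := fun _ => continuousOn_const
  have hpw₁ : WeaklyContinuous T p₁ := (hu₁.comp_clm e).sub hconst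
  have hpw₂ : WeaklyContinuous T p₂ := (hu₂.comp_clm e).sub hconst
  obtain ⟨M₁, hM₁⟩ := hpw₁.exists_norm_clamp_le hT.le
  obtain ⟨M₂, hM₂⟩ := hpw₂.exists_norm_clamp_le hT.le
  have hpc₁ := hpw₁.clamp hT.le
  have hpc₂ := hpw₂.clamp hT.le
  have hpm₁ := hpc₁.stronglyMeasurable
  have hpm₂ := hpc₂.stronglyMeasurable
  have hp : (fun t => e (clamp T w t)) = fun t => clamp T p₁ t - clamp T p₂ t := by
    ext1 t
    simp only [clamp, hw, hp₁, hp₂, map_sub, sub_sub_sub_cancel_right]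
  have hconv : ∀ t, conv T G (fun t => e (clamp T w t)) t
      = conv T G (clamp T p₁) t - conv T G (clamp T p₂) t := fun t => by
    rw [hp, conv_sub hGi hpm₁ hM₁ hpm₂ hM₂]
  have hcc₁ : WeakCont (conv T G (clamp T p₁)) := WeakCont.conv hGi hpm₁ hpc₁ hM₁
  have hcc₂ : WeakCont (conv T G (clamp T p₂)) := WeakCont.conv hGi hpm₂ hpc₂ hM₂
  have hmain : ∀ t ∈ Icc 0 T, ∀ r ∈ Icc 0 T, ⟪v t, ι (clamp T w r)⟫
      + ⟪conv T G (fun t => e (clamp T w t)) t, e (clamp T w r)⟫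
      + ∫ τ in (0 : ℝ)..t, ⟪Λ C (e (clamp T w τ)), e (clamp T w r)⟫ = 0 := by
    intro t ht r hr
    rw [clamp_of_mem w hr]
    set ψ := w r
    have hA : Continuous fun t => ⟪Λ C (e (clamp T w t)), e ψ⟫ :=
      ((hcw.comp_clm e).comp_clm (Λ C)).inner_right _
    have hcc : Continuous fun t => ⟪conv T G (fun t => e (clamp T w t)) t, e ψ⟫ := by
      simp only [hconv, inner_sub_left]
      exact (hcc₁.inner_right _).sub (hcc₂.inner_right _)
    -- The direction `ψ = w r` is frozen. The right-hand side `R η ψ` is the same for both solutions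
    -- and cancels, so neither linearity nor integrability of it is needed.
    have hbois := eq_sub_integral_of_integral_deriv_mul hT
      (p := fun t => ⟪v t, ι ψ⟫ + ⟪conv T G (fun t => e (clamp T w t)) t, e ψ⟫)
      (q := fun t => ⟪Λ C (e (clamp T w t)), e ψ⟫)
      ((hvw.inner_right _).add hcc.continuousOn) hA.continuousOn (by
        intro η h1 h2 h3
        have s₁ := integral_deriv_mul_eq_of_weak_formulation hT hGi hv₁ hpw₁
          (by simp [hp₁, hi₁]) h1 (he₁ η h1 h2 h3 ψ (hS r hr))
        have s₂ := integral_deriv_mul_eq_of_weak_formulation hT hGi hv₂ hpw₂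
          (by simp [hp₂, hi₂]) h1 (he₂ η h1 h2 h3 ψ (hS r hr))
        have hdη : Continuous (deriv η) := h1.continuous_deriv (by simp)
        have j : ∀ {v : ℝ → H} {p : ℝ → X}, WeaklyContinuous T v →
            WeakCont (conv T G (clamp T p)) → IntervalIntegrable
              (fun t => deriv η t * (⟪v t, ι ψ⟫ + ⟪conv T G (clamp T p) t, e ψ⟫))
              volume 0 T := by
          intro v p hv hc
          apply ContinuousOn.intervalIntegrable
          rw [uIcc_of_le hT.le]
          exact hdη.continuousOn.mul ((hv.inner_right _).add (hc.inner_right _).continuousOn)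
        have k : ∀ {u : ℝ → V}, WeaklyContinuous T u →
            IntervalIntegrable (fun t => η t * ⟪Λ C (e (u t)), e ψ⟫) volume 0 T := by
          intro u hu
          apply ContinuousOn.intervalIntegrable
          rw [uIcc_of_le hT.le]
          exact h1.continuous.continuousOn.mul
            (((hu.comp_clm e).comp_clm (Λ C)).inner_right _)
        have l1 := intervalIntegral.integral_sub (j hv₁ hcc₁) (j hv₂ hcc₂)
        have l2 := intervalIntegral.integral_sub (k hu₁) (k hu₂)
        have l3 : ∫ t in (0 : ℝ)..T, deriv η t * (⟪v t, ι ψ⟫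
              + ⟪conv T G (fun t => e (clamp T w t)) t, e ψ⟫)
            = ∫ t in (0 : ℝ)..T,
              (deriv η t * (⟪v₁ t, ι ψ⟫ + ⟪conv T G (clamp T p₁) t, e ψ⟫)
                - deriv η t * (⟪v₂ t, ι ψ⟫ + ⟪conv T G (clamp T p₂) t, e ψ⟫)) := by
          refine intervalIntegral.integral_congr fun t _ => ?_
          simp only [hconv, hv, inner_sub_left]
          ring
        have l4 : ∫ t in (0 : ℝ)..T, η t * ⟪Λ C (e (clamp T w t)), e ψ⟫
            = ∫ t in (0 : ℝ)..T, (η t * ⟪Λ C (e (u₁ t)), e ψ⟫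
              - η t * ⟪Λ C (e (u₂ t)), e ψ⟫) := by
          refine intervalIntegral.integral_congr fun t ht => ?_
          rw [uIcc_of_le hT.le] at ht
          simp only [clamp_of_mem w ht]
          simp only [hw, map_sub, inner_sub_left]
          ring
        rw [l3, l1, l4, l2, s₁, s₂]
        ring) t ht
    have hv0 : v 0 = 0 := by simp [hv, hv0₁, hv0₂]
    -- At time `0` the convolution sees only the past, where the extension of `w` is zero. With `v 0
    -- = 0` this removes the constant of integration.
    have hc0 : conv T G (fun t => e (clamp T w t)) 0 = 0 := by
      rw [conv_congr hT.le (q := fun _ => 0)]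
      · simp [conv]
      · intro r hr
        simp [clamp_of_nonpos hT.le w hr, hw0]
    simp only [hv0, hc0, inner_zero_left] at hbois
    linarith
  have hzero := eq_zero_of_integrated_equation hT hδ ι e hCs hC0 hGc hGi hFs hF0
    (fun s hs => by rw [hdG s hs]; exact hF₁0 s hs)
    (fun s hs => by rw [hddG s hs]; exact hF₂0 s hs)
    hcw hM (fun t ht => by rw [clamp_of_nonpos hT.le w ht, hw0])
    (continuous_clamp_of_inner_eq_integral hT.le hvw hderiv) hvw
    (fun t ht => by rw [clamp_of_mem w ht]; exact hderiv t ht) hmain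
  intro t ht
  have h1 := hzero t ht
  rwa [clamp_of_mem w ht] at h1

end Abstract

/-! ### Product test functions and the theorem. -/

section Concrete

variable {d : ℕ} {Ω D : Set (Vec d)} {Γt : ℝ → Set (Vec d)} {T : ℝ}

/-- This is where the crack must not move: a fixed `ψ` has to be admissible at all times, in
particular before the time at which it arises as a value of the difference. -/
theorem isTestFunction_smul {η : ℝ → ℝ} (h1 : ContDiff ℝ ∞ η) (h2 : HasCompactSupport η)
    (h3 : tsupport η ⊆ Ioo 0 T) (hΓ : ∀ t ∈ Icc 0 T, Γt t = Γt T) {ψ : H1 Ω (Γt T)}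
    (hψ : (ψ : L2Pair d Ω) ∈ H1D Ω D (Γt T)) : IsTestFunction Ω D Γt T fun t => η t • ψ := by
  refine ⟨(h1.of_le (by simp)).smul contDiff_const, h2.smul_right,
    (tsupport_smul_subset_left η fun _ => ψ).trans h3, fun t ht => ?_⟩
  rw [hΓ t ht]
  exact smul_mem_H1D hψ (η t)

/-- A generalized solution satisfies the abstract weak formulation, tested with `φ(t) = η(t) ψ`. -/
theorem weak_formulation_smul {C : TensorField d Ω} {F : ℝ → TensorField d Ω}
    {u0 : H1 Ω (Γt 0)} {u : ℝ → H1 Ω (Γt T)} {v : ℝ → L2Vec d Ω}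
    {N : ℝ → L2Bdry d (frontier Ω \ D)} {f : ℝ → L2Vec d Ω}
    {η : ℝ → ℝ} (hη : ContDiff ℝ ∞ η) {ψ : H1 Ω (Γt T)}
    (h : - (∫ t in (0 : ℝ)..T, ⟪v t, fn (deriv (fun t => η t • ψ) t)⟫)
        + (∫ t in (0 : ℝ)..T, tensorForm C (strain (u t)) (strain (η t • ψ)))
        - (∫ t in (0 : ℝ)..T, ∫ r in (0 : ℝ)..t,
            tensorForm (F (t - r)) (strain (u r) - strain u0)
              (strain (deriv (fun t => η t • ψ) t)))
      = (∫ t in (0 : ℝ)..T, ⟪f t, fn (η t • ψ)⟫)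
        + ∫ t in (0 : ℝ)..T, ∫ x, ⟪N t x, trace Ω (fn (η t • ψ)) x⟫
            ∂(surface (frontier Ω \ D))) :
    - (∫ t in (0 : ℝ)..T, ⟪v t, deriv η t • fnL d Ω ψ⟫)
        + (∫ t in (0 : ℝ)..T, ⟪tensorOp d Ω C (strainL d Ω (u t)), η t • strainL d Ω ψ⟫)
        - (∫ t in (0 : ℝ)..T, ∫ r in (0 : ℝ)..t,
            ⟪tensorOp d Ω (F (t - r)) (strainL d Ω (u r) - strainL d Ω u0),
              deriv η t • strainL d Ω ψ⟫)
      = (∫ t in (0 : ℝ)..T, ⟪f t, η t • fnL d Ω ψ⟫)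
        + ∫ t in (0 : ℝ)..T, ∫ x, ⟪N t x, trace Ω (η t • fnL d Ω ψ : L2Vec d Ω) x⟫
            ∂(surface (frontier Ω \ D)) := by
  have hdφ : ∀ t, deriv (fun t => η t • ψ) t = deriv η t • ψ := fun t =>
    ((hη.differentiable (by simp) t).hasDerivAt.smul_const ψ).deriv
  have hfn : ∀ c : ℝ, fn (c • ψ) = c • fnL d Ω ψ := fun c =>
    (fnL d Ω).map_smul c (ψ : L2Pair d Ω)
  have hst : ∀ c : ℝ, strain (c • ψ) = c • strainL d Ω ψ := fun c =>
    (strainL d Ω).map_smul c (ψ : L2Pair d Ω)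
  simp only [hdφ, hfn, hst, ← inner_tensorOp, strain_eq] at h
  exact h

end Concrete

end FracKV

open FracKV in
theorem mainTheorem4 {d : ℕ} (hd : 1 ≤ d)
    {Ω D Γ : Set (FracKV.Vec d)} {Γt : ℝ → Set (FracKV.Vec d)} {T δ₀ : ℝ}
    (hT : 0 < T) (hδ₀ : 0 < δ₀)
    (hgeo : FracKV.CrackGeometry Ω D Γ Γt T)
    (z : ℝ → FracKV.H1 Ω (Γt 0)) (hz : FracKV.MemW21 T z)
    (N : ℝ → FracKV.L2Bdry d (frontier Ω \ D)) (hN : FracKV.MemW11 T N)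
    (f : ℝ → FracKV.L2Vec d Ω) (hf : MemLp f 2 (volume.restrict (Ioo 0 T)))
    (u0 : FracKV.H1 Ω (Γt 0)) (hu0 : ((u0 - z 0 : FracKV.H1 Ω (Γt 0)) : FracKV.L2Pair d Ω) ∈
      FracKV.H1D Ω D (Γt 0))
    (u1 : FracKV.L2Vec d Ω)
    (C : FracKV.TensorField d Ω) (hC_symm : FracKV.TensorSymm C) (hC : FracKV.TensorCoercive C)
    (F : ℝ → FracKV.TensorField d Ω)
    (hF_symm : ∀ t ∈ Ioo 0 (T + δ₀), FracKV.TensorSymm (F t))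
    (hF_smooth : ContDiffOn ℝ 2 F (Ioo 0 (T + δ₀)))
    (hF_int : IntegrableOn F (Ioo 0 (T + δ₀)))
    (hF_nonneg : ∀ t ∈ Ioo 0 (T + δ₀), FracKV.TensorNonneg (F t))
    (hF_deriv : ∀ t ∈ Ioo 0 (T + δ₀), FracKV.TensorNonpos (deriv F t))
    (hF_deriv2 : ∀ t ∈ Ioo 0 (T + δ₀), FracKV.TensorNonneg (deriv (deriv F) t))
    (hcrack : Γt T = Γt 0)
    (u₁ u₂ : ℝ → FracKV.H1 Ω (Γt T))
    (hu₁ : FracKV.IsGeneralizedSolution Ω D Γt T z N f u0 u1 C F u₁)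
    (hu₂ : FracKV.IsGeneralizedSolution Ω D Γt T z N f u0 u1 C F u₂) :
    ∀ t ∈ Icc 0 T, u₁ t = u₂ t := by
  obtain ⟨hw₁, -, hD₁, hi₁, v₁, hv₁, hd₁, hv0₁, he₁⟩ := hu₁
  obtain ⟨hw₂, -, hD₂, hi₂, v₂, hv₂, hd₂, hv0₂, he₂⟩ := hu₂
  have h0T : (0 : ℝ) ∈ Icc 0 T := ⟨le_rfl, hT.le⟩
  have hTT : T ∈ Icc 0 T := ⟨hT.le, le_rfl⟩
  have hΓ : ∀ t ∈ Icc 0 T, Γt t = Γt T := fun t ht =>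
    (hgeo.evolving_mono ht hTT ht.2).antisymm
      (hcrack.le.trans (hgeo.evolving_mono h0T ht ht.1))
  have : SecondCountableTopology (L2Pair d Ω) := secondCountableTopology_L2Pair
  have : SecondCountableTopology (L2Sym d Ω) := secondCountableTopology_Lp
  -- The Dirichlet datum `z t` cancels in the difference.
  have hS : ∀ t ∈ Icc 0 T, (u₁ t : L2Pair d Ω) - (u₂ t : L2Pair d Ω) ∈ H1D Ω D (Γt T) := by
    intro t ht
    have h1 := sub_mem_H1D (hD₁ t ht) (hD₂ t ht)
    rwa [sub_sub_sub_cancel_right, hΓ t ht] at h1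
  -- The solutions are viewed in the ambient pair space, which is complete and separable, so
  -- completeness of `H1` plays no role.
  have hU₁ : WeaklyContinuous T fun t => (u₁ t : L2Pair d Ω) :=
    hw₁.comp_clm (H1 Ω (Γt T)).subtypeL
  have hU₂ : WeaklyContinuous T fun t => (u₂ t : L2Pair d Ω) :=
    hw₂.comp_clm (H1 Ω (Γt T)).subtypeL
  have hzero : ∀ t ∈ Icc 0 T, fnL d Ω ((u₁ t : L2Pair d Ω) - (u₂ t : L2Pair d Ω)) = 0 := by
    refine eq_of_abstract_weak_formulation (V := L2Pair d Ω) (H := L2Vec d Ω)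
      (X := L2Sym d Ω) (B := TensorField d Ω) (C := C) (F := F) (S := H1D Ω D (Γt T))
      (u₁ := fun t => (u₁ t : L2Pair d Ω)) (u₂ := fun t => (u₂ t : L2Pair d Ω))
      (v₁ := v₁) (v₂ := v₂) (u0 := u0) (u1 := u1)
      (R := fun η ψ => (∫ t in (0 : ℝ)..T, ⟪f t, η t • fnL d Ω ψ⟫)
        + ∫ t in (0 : ℝ)..T, ∫ x, ⟪N t x, trace Ω (η t • fnL d Ω ψ : L2Vec d Ω) x⟫
            ∂(surface (frontier Ω \ D)))
      hT hδ₀ (fnL d Ω) (strainL d Ω) (tensorOp d Ω)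
      ?_ ?_ ?_ ?_ ?_ ?_ ?_ ?_ ?_ ?_ ?_ ?_ ?_ ?_ ?_ ?_ ?_ ?_ ?_ ?_ ?_
    · exact hC_symm.inner_tensorOp
    · exact hC.nonneg.inner_tensorOp
    · exact hF_smooth
    · exact hF_int
    · exact fun s hs => (hF_symm s hs).inner_tensorOp
    · exact fun s hs => (hF_nonneg s hs).inner_tensorOp
    · exact fun s hs => (hF_deriv s hs).inner_tensorOp
    · exact fun s hs => (hF_deriv2 s hs).inner_tensorOp
    · exact hU₁
    · exact hU₂
    · exact hi₁
    · exact hi₂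
    · exact hS
    · exact hv₁
    · exact hv₂
    · exact hd₁
    · exact hd₂
    · exact hv0₁
    · exact hv0₂
    · exact fun η h1 h2 h3 ψ hψ => weak_formulation_smul (ψ := ⟨ψ, hψ.1⟩) h1
        (he₁ _ (isTestFunction_smul h1 h2 h3 hΓ hψ))
    · exact fun η h1 h2 h3 ψ hψ => weak_formulation_smul (ψ := ⟨ψ, hψ.1⟩) h1
        (he₂ _ (isTestFunction_smul h1 h2 h3 hΓ hψ))
  intro t ht
  -- The energy argument gives equality in `L²` only. Equality of the gradients follows off the
  -- closed null set `Γt T`.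
  have h2 := eq_zero_of_mem_H1_of_fst_eq_zero hgeo.isOpen (hgeo.evolving_closed T hTT)
    (measure_mono_null (hgeo.evolving_subset T hTT) hgeo.crack_null) (hS t ht).1 (hzero t ht)
  exact Subtype.ext (sub_eq_zero.1 h2)
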